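/- Let $0<\epsilon<1$. Let $H_n(x)=(-1)^ne^{x^2}\frac{d^n}{dx^n}e^{-x^2}$ be the Hermite polynomials and $h_n(x)=(n!\,2^n\sqrt\pi)^{-1/2}H_n(x)e^{-x^2/2}$, $n=0,1,2,\dots$, the Hermite functions, which form an orthonormal basis of $L^2(\mathbb R)$. Let $dz$ denote Lebesgue area measure on $\mathbb C$, $d\mu_\epsilon(z)=e^{-2\epsilon|z|^2/(1-\epsilon^2)}\,dz$, and let $\mathcal F_\epsilon$ be the Fock space of all entire functions in $L^2(\mathbb C,d\mu_\epsilon)$. Then the functions $$E_n(z)=\frac{\epsilon^{n/2}}{\sqrt{n!\,2^n\pi^{1/2}}}\,\frac{\sqrt{2\epsilon}}{\sqrt[4]{(1-\epsilon^2)\pi}}\,H_n(z)\,e^{\epsilon^2z^2/(1-\epsilon^2)},\qquad n=0,1,2,\dots,$$ form an orthonormal basis of $\mathcal F_\epsilon$, so that $Vf=\sum_n\langle f,h_n\rangle E_n$ defines a unitary map $V$ of $L^2(\mathbb R)$ onto $\mathcal F_\epsilon$ with $Vh_n=E_n$. For $\phi\in L^\infty(\mathbb C)$ let $T_\phi$ be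 the Toeplitz operator $T_\phi u=P(\phi u)$ on $\mathcal F_\epsilon$, where $P$ is the orthogonal projection of $L^2(\mathbb C,d\mu_\epsilon)$ onto $\mathcal F_\epsilon$. Then, for every $\phi\in L^\infty(\mathbb C)$, $$V^*T_\phi V=W_a,\qquad a(x,\xi)=\Big(e^{\frac{1-\epsilon^2}{16\epsilon}\Delta}\phi\Big)\Big(\frac{1+\epsilon}{2\sqrt\epsilon}x-\frac{1-\epsilon}{2\sqrt\epsilon}i\xi\Big),\qquad x,\xi\in\mathbb R,$$ where $e^{t\Delta}\phi(w)=\frac1{4\pi t}\int_{\mathbb C}\phi(z)e^{-|z-w|^2/(4t)}\,dz$ for $t>0$, and $W_a$ is the Weyl operator with symbol $a$, that is, the unique bounded operator on $L^2(\mathbb R)$ such that, for every Schwartz function $f$ on $\mathbb R$, $$W_af(x)=\int_{\mathbb R}\Big(\int_{\mathbb R}a\big(\tfrac{x+y}2,\xi\big)e^{i(x-y)\xi}f(y)\,dy\Big)\frac{d\xi}{2\pi}\qquad\text{for almost every }x,$$ the inner integral being absolutely convergent for all $x$ and $\xi$, and its value being absolutely integrable in $\xi$ for all $x$. -/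

import Mathlib

open MeasureTheory Filter Topology
open scoped ENNReal SchwartzMap

noncomputable section

namespace HermiteFock

/-! ### Hermite polynomials and Hermite functions -/

/-- The (physicists') Hermite polynomials `H_n`, with `H_0 = 1`, `H_{n+1} = 2 X H_n - H_n'`. -/
def hermiteH : ℕ → Polynomial ℤ
  | 0 => 1
  | n + 1 => 2 * Polynomial.X * hermiteH n - Polynomial.derivative (hermiteH n)

/-- Rodrigues' formula `H_n(x) = (-1)^n e^{x^2} (d/dx)^n e^{-x^2}`. -/
theorem hermiteH_rodrigues (n : ℕ) (x : ℝ) :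
    Polynomial.aeval x (hermiteH n)
      = (-1) ^ n * Real.exp (x ^ 2) * iteratedDeriv n (fun t : ℝ => Real.exp (-t ^ 2)) x := by
  have key : ∀ n : ℕ, iteratedDeriv n (fun t : ℝ => Real.exp (-t ^ 2))
      = fun x => (-1) ^ n * (Polynomial.aeval x (hermiteH n) * Real.exp (-x ^ 2)) := by
    intro n
    induction n with
    | zero => funext x; simp [hermiteH]
    | succ n ih =>
      funext x
      rw [iteratedDeriv_succ, ih]
      have h1 : HasDerivAt (fun t : ℝ => Polynomial.aeval t (hermiteH n))
          (Polynomial.aeval x (Polynomial.derivative (hermiteH n))) x :=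
        Polynomial.hasDerivAt_aeval _ _
      have h2 : HasDerivAt (fun t : ℝ => Real.exp (-t ^ 2))
          (Real.exp (-x ^ 2) * (-(2 * x))) x := by
        have := ((hasDerivAt_pow 2 x).neg).exp
        simpa using this
      have h3 : HasDerivAt (fun t : ℝ => (-1 : ℝ) ^ n *
          (Polynomial.aeval t (hermiteH n) * Real.exp (-t ^ 2))) _ x :=
        (h1.mul h2).const_mul ((-1 : ℝ) ^ n)
      rw [h3.deriv]
      simp only [hermiteH, map_sub, map_mul, Polynomial.aeval_X, map_ofNat]
      ring
  rw [key n]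
  simp only [Real.exp_neg]
  have : ((-1 : ℝ) ^ n) * (-1) ^ n = 1 := by rw [← mul_pow]; simp
  field_simp
  rw [← pow_mul, mul_comm n 2, pow_mul]; simp

/-- The Hermite functions `h_n(x) = (n! 2^n √π)^{-1/2} H_n(x) e^{-x²/2}`. -/
def hermiteFun (n : ℕ) (x : ℝ) : ℂ :=
  ((√(n.factorial * 2 ^ n * √Real.pi))⁻¹ : ℝ) * Polynomial.aeval (x : ℂ) (hermiteH n)
    * Complex.exp (-(x : ℂ) ^ 2 / 2)

/-- The functions `E_n(z) = (ε^{n/2} / √(n! 2^n π^{1/2})) (√(2ε) / ((1-ε²)π)^{1/4})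
H_n(z) e^{ε² z² / (1-ε²)}` on `ℂ`. -/
def fockFun (ε : ℝ) (n : ℕ) (z : ℂ) : ℂ :=
  ((√(ε ^ n) / √(n.factorial * 2 ^ n * √Real.pi))
      * (√(2 * ε) / ((1 - ε ^ 2) * Real.pi) ^ (1 / 4 : ℝ)) : ℝ)
    * Polynomial.aeval z (hermiteH n) * Complex.exp ((ε ^ 2 / (1 - ε ^ 2) : ℝ) * z ^ 2)

theorem aeval_bound (p : Polynomial ℤ) : ∀ η : ℝ, 0 < η →
    ∃ C : ℝ, 0 ≤ C ∧ ∀ z : ℂ, ‖Polynomial.aeval z p‖ ≤ C * Real.exp (η * ‖z‖ ^ 2) := by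
  induction p using Polynomial.induction_on' with
  | add p q hp hq =>
    intro η hη
    obtain ⟨C, hC, h1⟩ := hp η hη
    obtain ⟨D, hD, h2⟩ := hq η hη
    refine ⟨C + D, by positivity, fun z => ?_⟩
    rw [map_add, add_mul]
    exact (norm_add_le _ _).trans (add_le_add (h1 z) (h2 z))
  | monomial n a =>
    intro η hη
    refine ⟨‖(a : ℂ)‖ * (1 + n.factorial / η ^ n), by positivity, fun z => ?_⟩
    rw [Polynomial.aeval_monomial, norm_mul, norm_pow, mul_assoc]
    refine mul_le_mul_of_nonneg_left ?_ (norm_nonneg _)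
    have hx : 0 ≤ η * ‖z‖ ^ 2 := by positivity
    have h1 : (1 : ℝ) ≤ Real.exp (η * ‖z‖ ^ 2) := Real.one_le_exp hx
    have h2 : ‖z‖ ^ n ≤ 1 + (‖z‖ ^ 2) ^ n := by
      have := sq_nonneg (‖z‖ ^ n - 1)
      rw [← pow_mul, mul_comm 2 n, pow_mul]
      nlinarith [pow_nonneg (norm_nonneg z) n]
    have h3 : (‖z‖ ^ 2) ^ n ≤ n.factorial / η ^ n * Real.exp (η * ‖z‖ ^ 2) := by
      have := Real.pow_div_factorial_le_exp _ hx n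
      rw [mul_pow, div_le_iff₀ (by positivity)] at this
      rw [div_mul_eq_mul_div, le_div_iff₀ (by positivity)]
      linarith
    nlinarith

theorem memLp_hermiteFun (n : ℕ) : MemLp (hermiteFun n) 2 (volume : Measure ℝ) := by
  obtain ⟨C, hC, h⟩ := aeval_bound (hermiteH n) (1 / 4) (by norm_num)
  have hcont : Continuous (hermiteFun n) := by
    unfold hermiteFun
    have : Continuous fun x : ℝ => Polynomial.aeval (x : ℂ) (hermiteH n) :=
      (Polynomial.continuous_aeval _).comp Complex.continuous_ofReal
    fun_prop
  set K : ℝ := ‖(((√(n.factorial * 2 ^ n * √Real.pi))⁻¹ : ℝ) : ℂ)‖ * C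
  have hg : MemLp (fun x : ℝ => K * Real.exp (-(1 / 4) * x ^ 2)) 2 volume := by
    refine MemLp.const_mul ?_ K
    rw [memLp_two_iff_integrable_sq (by fun_prop)]
    refine (integrable_exp_neg_mul_sq (b := 1 / 2) (by norm_num)).congr (ae_of_all _ fun x => ?_)
    simp only [← Real.exp_nat_mul]
    congr 1
    push_cast
    ring
  refine hg.mono hcont.aestronglyMeasurable (ae_of_all _ fun x => ?_)
  have h' := h x
  have e1 : ‖Complex.exp (-(x : ℂ) ^ 2 / 2)‖ = Real.exp (-x ^ 2 / 2) := by
    rw [Complex.norm_exp]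
    norm_cast
  have hK : 0 ≤ K := by positivity
  rw [hermiteFun, norm_mul, norm_mul, e1, Real.norm_of_nonneg (by positivity)]
  have e2 : Real.exp (-(1 / 4) * x ^ 2) = Real.exp (1 / 4 * x ^ 2) * Real.exp (-x ^ 2 / 2) := by
    rw [← Real.exp_add]
    congr 1
    ring
  rw [e2, ← mul_assoc]
  refine mul_le_mul_of_nonneg_right ?_ (by positivity)
  rw [mul_assoc _ C]
  refine mul_le_mul_of_nonneg_left ?_ (norm_nonneg _)
  simpa using h'

/-- The Hermite functions as elements of `L²(ℝ)`. -/
def hermiteL2 (n : ℕ) : Lp ℂ 2 (volume : Measure ℝ) := (memLp_hermiteFun n).toLp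

/-! ### The Fock space -/

/-- The Gaussian measure `dμ_ε(z) = e^{-2ε|z|²/(1-ε²)} dz` on `ℂ`, `dz` the Lebesgue measure. -/
def fockMeasure (ε : ℝ) : Measure ℂ :=
  (volume : Measure ℂ).withDensity
    fun z => ENNReal.ofReal (Real.exp (-(2 * ε * ‖z‖ ^ 2 / (1 - ε ^ 2))))

/-- The Fock space: the subspace of `L²(ℂ, μ_ε)` of (classes of) entire functions. -/
def fockSpace (ε : ℝ) : Submodule ℂ (Lp ℂ 2 (fockMeasure ε)) where
  carrier := {f | ∃ F : ℂ → ℂ, Differentiable ℂ F ∧ f =ᵐ[fockMeasure ε] F}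
  add_mem' := by
    rintro f g ⟨F, hF, hf⟩ ⟨G, hG, hg⟩
    exact ⟨F + G, hF.add hG, (Lp.coeFn_add f g).trans (hf.add hg)⟩
  zero_mem' := ⟨0, differentiable_const 0, Lp.coeFn_zero _ _ _⟩
  smul_mem' := by
    rintro c f ⟨F, hF, hf⟩
    exact ⟨c • F, hF.const_smul c, (Lp.coeFn_smul c f).trans (hf.const_smul c)⟩

theorem fockMeasure_ac (ε : ℝ) : fockMeasure ε ≪ volume :=
  withDensity_absolutelyContinuous _ _

/-- Local sub-mean value inequality for entire functions. -/
theorem enorm_le_lintegral_ball {F : ℂ → ℂ} (hF : Differentiable ℂ F) (z : ℂ) :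
    ‖F z‖ₑ ≤ ∫⁻ w in Metric.ball z 2, ‖F w‖ₑ := by
  have hc : Continuous F := hF.continuous
  have hmean : ∀ r : ℝ, ‖F z‖ₑ ≤
      ∫⁻ θ in Set.Ioo (-Real.pi) Real.pi, ‖F (z + Complex.polarCoord.symm (r, θ))‖ₑ := by
    intro r
    have h1 : Real.circleAverage F z r = F z :=
      DiffContOnCl.circleAverage hF.diffContOnCl
    have hper : Function.Periodic (fun θ : ℝ => F (circleMap z r θ)) (2 * Real.pi) :=
      (periodic_circleMap z r).comp F
    have h2 : ∫ θ in (0 : ℝ)..(2 * Real.pi), F (circleMap z r θ)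
        = ∫ θ in (-Real.pi)..Real.pi, F (circleMap z r θ) := by
      have := hper.intervalIntegral_add_eq 0 (-Real.pi)
      simp only [zero_add] at this
      rw [this]
      congr 1
      ring
    rw [Real.circleAverage_def, h2,
      intervalIntegral.integral_of_le (by linarith [Real.pi_pos]),
      integral_Ioc_eq_integral_Ioo] at h1
    rw [← h1, enorm_smul]
    have h3 : ‖((2 * Real.pi)⁻¹ : ℝ)‖ₑ ≤ 1 := by
      rw [Real.enorm_of_nonneg (by positivity)]
      refine ENNReal.ofReal_le_one.2 (inv_le_one_of_one_le₀ ?_)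
      linarith [Real.pi_gt_three]
    refine (mul_le_mul_left h3 _).trans ?_
    rw [one_mul]
    refine (enorm_integral_le_lintegral_enorm _).trans (le_of_eq ?_)
    refine lintegral_congr fun θ => ?_
    congr 2
    rw [Complex.polarCoord_symm_apply, circleMap, Complex.exp_mul_I]
    simp
  have hshift : ∫⁻ w in Metric.ball z 2, ‖F w‖ₑ
      = ∫⁻ w, (Metric.ball (0 : ℂ) 2).indicator (fun w => ‖F (z + w)‖ₑ) w := by
    rw [← lintegral_indicator Metric.isOpen_ball.measurableSet,
      ← lintegral_add_left_eq_self _ z]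
    refine lintegral_congr fun w => ?_
    by_cases hw : w ∈ Metric.ball (0 : ℂ) 2
    · have : z + w ∈ Metric.ball z 2 := by simpa using hw
      simp only [Set.indicator_of_mem hw, Set.indicator_of_mem this]
    · have : z + w ∉ Metric.ball z 2 := by simpa using hw
      simp only [Set.indicator_of_notMem hw, Set.indicator_of_notMem this]
  rw [hshift, ← Complex.lintegral_comp_polarCoord_symm]
  have hsub : Set.Ioo (1 : ℝ) 2 ×ˢ Set.Ioo (-Real.pi) Real.pi ⊆ polarCoord.target := by
    rintro ⟨r, θ⟩ ⟨hr, hθ⟩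
    exact ⟨by simpa using lt_trans one_pos hr.1, hθ⟩
  have hms : MeasurableSet (Set.Ioo (1 : ℝ) 2 ×ˢ Set.Ioo (-Real.pi) Real.pi) :=
    measurableSet_Ioo.prod measurableSet_Ioo
  refine le_trans ?_ (lintegral_mono_set hsub)
  have hle : ∫⁻ p in Set.Ioo (1 : ℝ) 2 ×ˢ Set.Ioo (-Real.pi) Real.pi,
        ‖F (z + Complex.polarCoord.symm p)‖ₑ
      ≤ ∫⁻ p in Set.Ioo (1 : ℝ) 2 ×ˢ Set.Ioo (-Real.pi) Real.pi, ENNReal.ofReal p.1 •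
        (Metric.ball (0 : ℂ) 2).indicator (fun w => ‖F (z + w)‖ₑ)
          (Complex.polarCoord.symm p) := by
    refine setLIntegral_mono' hms ?_
    rintro ⟨r, θ⟩ ⟨hr, hθ⟩
    have hr0 : (0 : ℝ) < r := lt_trans one_pos hr.1
    have hb : Complex.polarCoord.symm (r, θ) ∈ Metric.ball (0 : ℂ) 2 := by
      rw [mem_ball_zero_iff, Complex.norm_polarCoord_symm, abs_of_pos hr0]
      exact hr.2
    rw [Set.indicator_of_mem hb, smul_eq_mul]
    have : (1 : ℝ≥0∞) ≤ ENNReal.ofReal r := ENNReal.one_le_ofReal.2 hr.1.le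
    calc ‖F (z + Complex.polarCoord.symm (r, θ))‖ₑ
        = 1 * ‖F (z + Complex.polarCoord.symm (r, θ))‖ₑ := (one_mul _).symm
      _ ≤ _ := mul_le_mul_left this _
  refine le_trans ?_ hle
  have hpc : Continuous fun p : ℝ × ℝ => (Complex.polarCoord.symm p : ℂ) := by
    simp only [Complex.polarCoord_symm_apply]
    fun_prop
  rw [Measure.volume_eq_prod, setLIntegral_prod _ (by fun_prop)]
  calc ‖F z‖ₑ = ∫⁻ r in Set.Ioo (1 : ℝ) 2, ‖F z‖ₑ := by
        rw [setLIntegral_const, Real.volume_Ioo]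
        norm_num
    _ ≤ _ := lintegral_mono fun r => hmean r

/-- Point evaluations are bounded for the `L²(μ_ε)` norm, locally uniformly. -/
theorem enorm_le_eLpNorm (ε R : ℝ) : ∃ C : ℝ≥0∞, C ≠ ∞ ∧ ∀ F : ℂ → ℂ, Differentiable ℂ F →
    ∀ z ∈ Metric.closedBall (0 : ℂ) R, ‖F z‖ₑ ≤ C * eLpNorm F 2 (fockMeasure ε) := by
  set d : ℂ → ℝ := fun z => Real.exp (-(2 * ε * ‖z‖ ^ 2 / (1 - ε ^ 2))) with hd
  have hdc : Continuous d := by simp only [hd]; fun_prop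
  obtain ⟨m, hm, hmd⟩ : ∃ m : ℝ, 0 < m ∧ ∀ z ∈ Metric.closedBall (0 : ℂ) (R + 2), m ≤ d z := by
    rcases (Metric.closedBall (0 : ℂ) (R + 2)).eq_empty_or_nonempty with h | h
    · exact ⟨1, one_pos, by simp [h]⟩
    · obtain ⟨x, -, hx⟩ := (isCompact_closedBall (0 : ℂ) (R + 2)).exists_isMinOn h hdc.continuousOn
      exact ⟨d x, Real.exp_pos _, fun z hz => hx hz⟩
  set V : ℝ≥0∞ := volume (Metric.ball (0 : ℂ) 2)
  set M : ℝ≥0∞ := (ENNReal.ofReal m)⁻¹ with hM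
  have hm0 : ENNReal.ofReal m ≠ 0 := by simpa using hm
  have hMt : M ≠ ∞ := by simpa [hM] using hm
  have hVt : V ≠ ∞ := measure_ball_lt_top.ne
  refine ⟨M ^ (1 / 2 : ℝ) * V ^ (1 / 2 : ℝ), ENNReal.mul_ne_top
    (ENNReal.rpow_ne_top_of_nonneg (by norm_num) hMt)
    (ENNReal.rpow_ne_top_of_nonneg (by norm_num) hVt), fun F hF z hz => ?_⟩
  have hmeas : (volume : Measure ℂ).restrict (Metric.ball z 2) ≤ M • fockMeasure ε := by
    refine Measure.le_iff.2 fun s hs => ?_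
    rw [Measure.smul_apply, smul_eq_mul, Measure.restrict_apply hs, hM,
      ← ENNReal.div_eq_inv_mul, ENNReal.le_div_iff_mul_le (Or.inl hm0)
        (Or.inl ENNReal.ofReal_ne_top), mul_comm, fockMeasure, withDensity_apply _ hs]
    have hsb : MeasurableSet (s ∩ Metric.ball z 2) := hs.inter Metric.isOpen_ball.measurableSet
    rw [← setLIntegral_const]
    refine (setLIntegral_mono' hsb fun w hw => ENNReal.ofReal_le_ofReal (hmd w ?_)).trans
      (lintegral_mono_set Set.inter_subset_left)
    rw [mem_closedBall_zero_iff] at hz ⊢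
    have h1 : ‖w - z‖ < 2 := by simpa [dist_eq_norm] using hw.2
    have h2 : ‖w‖ ≤ ‖z‖ + ‖w - z‖ := by
      simpa using norm_add_le z (w - z)
    linarith
  have hFm : AEStronglyMeasurable F ((volume : Measure ℂ).restrict (Metric.ball z 2)) :=
    hF.continuous.aestronglyMeasurable
  have h1 := eLpNorm_le_eLpNorm_mul_rpow_measure_univ (p := 1) (q := 2) (by norm_num) hFm
  have h2 : eLpNorm F 2 ((volume : Measure ℂ).restrict (Metric.ball z 2))
      ≤ M ^ (1 / 2 : ℝ) * eLpNorm F 2 (fockMeasure ε) := by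
    refine (eLpNorm_mono_measure F hmeas).trans (le_of_eq ?_)
    rw [eLpNorm_smul_measure_of_ne_top (by norm_num)]
    simp
  have h3 : (volume : Measure ℂ).restrict (Metric.ball z 2) Set.univ = V := by
    rw [Measure.restrict_apply_univ, Complex.volume_ball, ← Complex.volume_ball 0]
  rw [h3, eLpNorm_one_eq_lintegral_enorm] at h1
  refine (enorm_le_lintegral_ball hF z).trans (h1.trans ?_)
  have e : (1 / (1 : ℝ≥0∞).toReal - 1 / (2 : ℝ≥0∞).toReal : ℝ) = 1 / 2 := by norm_num
  rw [e]
  calc _ ≤ (M ^ (1 / 2 : ℝ) * eLpNorm F 2 (fockMeasure ε)) * V ^ (1 / 2 : ℝ) :=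
        mul_le_mul_left h2 _
    _ = _ := by ring

theorem isClosed_fockSpace (ε : ℝ) : IsClosed (fockSpace ε : Set (Lp ℂ 2 (fockMeasure ε))) := by
  refine IsSeqClosed.isClosed fun f g hf hfg => ?_
  choose F hF hfF using hf
  have hcauchy : ∀ R : ℝ, UniformCauchySeqOn F atTop (Metric.closedBall (0 : ℂ) R) := by
    intro R
    obtain ⟨C, hC, hCb⟩ := enorm_le_eLpNorm ε R
    have hlim : Tendsto (fun m : ℕ × ℕ => C * edist (f m.1) (f m.2)) (atTop ×ˢ atTop) (𝓝 0) := by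
      have h1 : Tendsto (fun m : ℕ × ℕ => edist (f m.1) (f m.2)) (atTop ×ˢ atTop)
          (𝓝 (edist g g)) :=
        (hfg.comp tendsto_fst).edist (hfg.comp tendsto_snd)
      rw [edist_self] at h1
      simpa using ENNReal.Tendsto.const_mul h1 (Or.inr hC)
    intro u hu
    obtain ⟨δ, hδ, hδu⟩ := mem_uniformity_edist.1 hu
    filter_upwards [hlim.eventually (gt_mem_nhds hδ)] with m hm z hz
    refine hδu ?_
    refine lt_of_le_of_lt ?_ hm
    have h2 := hCb _ ((hF m.1).sub (hF m.2)) z hz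
    rw [Lp.edist_def, edist_eq_enorm_sub]
    rw [eLpNorm_congr_ae ((hfF m.1).sub (hfF m.2))]
    exact h2
  have hpt : ∀ z, ∃ l, Tendsto (fun n => F n z) atTop (𝓝 l) := fun z =>
    cauchySeq_tendsto_of_complete ((hcauchy ‖z‖).cauchySeq (by simp))
  choose G hG using hpt
  have hloc : TendstoLocallyUniformlyOn F G atTop Set.univ := by
    rw [tendstoLocallyUniformlyOn_iff_forall_isCompact isOpen_univ]
    intro K _ hK
    obtain ⟨R, hR⟩ := hK.isBounded.subset_closedBall (0 : ℂ)
    exact ((hcauchy R).mono hR).tendstoUniformlyOn_of_tendsto fun z _ => hG z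
  have hGd : Differentiable ℂ G := differentiableOn_univ.1
    (hloc.differentiableOn (Eventually.of_forall fun n => (hF n).differentiableOn) isOpen_univ)
  refine ⟨G, hGd, ?_⟩
  obtain ⟨ns, hns, hae⟩ := (tendstoInMeasure_of_tendsto_Lp hfg).exists_seq_tendsto_ae
  filter_upwards [hae, ae_all_iff.2 hfF] with z h1 h2
  refine tendsto_nhds_unique h1 ?_
  simp only [h2]
  exact (hG z).comp hns.tendsto_atTop

instance instCompleteSpaceFockSpace (ε : ℝ) : CompleteSpace (fockSpace ε) :=
  (isClosed_fockSpace ε).completeSpace_coe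

theorem memLp_fockFun {ε : ℝ} (h0 : 0 < ε) (h1 : ε < 1) (n : ℕ) :
    MemLp (fockFun ε n) 2 (fockMeasure ε) := by
  have h2 : (0 : ℝ) < 1 - ε ^ 2 := by nlinarith
  set δ : ℝ := 2 * ε / (1 + ε) with hδ
  have hδ0 : 0 < δ := by positivity
  obtain ⟨C, hC, h⟩ := aeval_bound (hermiteH n) (δ / 4) (by positivity)
  have hcont : Continuous (fockFun ε n) := by
    unfold fockFun
    have : Continuous fun z : ℂ => Polynomial.aeval z (hermiteH n) :=
      Polynomial.continuous_aeval _
    fun_prop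
  obtain ⟨K, hK⟩ : ∃ K : ℂ, K = (((√(ε ^ n) / √(n.factorial * 2 ^ n * √Real.pi))
      * (√(2 * ε) / ((1 - ε ^ 2) * Real.pi) ^ (1 / 4 : ℝ)) : ℝ) : ℂ) := ⟨_, rfl⟩
  rw [memLp_two_iff_integrable_sq_norm hcont.aestronglyMeasurable, fockMeasure,
    integrable_withDensity_iff_integrable_smul' (by fun_prop) (by simp)]
  simp only [ENNReal.toReal_ofReal (Real.exp_pos _).le]
  have hgauss : Integrable (fun z : ℂ => (‖K‖ * C) ^ 2 * Real.exp (-(δ / 2) * ‖z‖ ^ 2)) := by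
    refine Integrable.const_mul ?_ _
    have := (GaussianFourier.integrable_cexp_neg_mul_sq_norm_add (V := ℂ) (b := (δ / 2 : ℝ))
      (by simpa using hδ0) 0 0).norm
    refine this.congr (ae_of_all _ fun z => ?_)
    simp only [Complex.norm_exp]
    congr 1
    simp [← Complex.ofReal_pow]
  refine hgauss.mono' (by fun_prop) (ae_of_all _ fun z => ?_)
  have e0 : ‖Complex.exp ((ε ^ 2 / (1 - ε ^ 2) : ℝ) * z ^ 2)‖
      ≤ Real.exp (ε ^ 2 / (1 - ε ^ 2) * ‖z‖ ^ 2) := by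
    rw [Complex.norm_exp, Complex.re_ofReal_mul]
    refine Real.exp_le_exp.2 (mul_le_mul_of_nonneg_left ?_ (by positivity))
    exact (Complex.re_le_norm _).trans (by rw [norm_pow])
  have e1 : ‖fockFun ε n z‖ ≤ ‖K‖ * C *
      (Real.exp (δ / 4 * ‖z‖ ^ 2) * Real.exp (ε ^ 2 / (1 - ε ^ 2) * ‖z‖ ^ 2)) := by
    have h6 : ‖K‖ * ‖Polynomial.aeval z (hermiteH n)‖ ≤ ‖K‖ * C * Real.exp (δ / 4 * ‖z‖ ^ 2) := by
      rw [mul_assoc]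
      exact mul_le_mul_of_nonneg_left (h z) (norm_nonneg _)
    rw [fockFun, ← hK, norm_mul, norm_mul, ← mul_assoc]
    exact mul_le_mul h6 e0 (norm_nonneg _) (by positivity)
  rw [smul_eq_mul, Real.norm_of_nonneg (by positivity)]
  calc _ ≤ Real.exp (-(2 * ε * ‖z‖ ^ 2 / (1 - ε ^ 2))) * (‖K‖ * C *
      (Real.exp (δ / 4 * ‖z‖ ^ 2) * Real.exp (ε ^ 2 / (1 - ε ^ 2) * ‖z‖ ^ 2))) ^ 2 := by
        gcongr
    _ = _ := by
        rw [mul_pow, mul_left_comm, ← Real.exp_add, ← Real.exp_nat_mul, ← Real.exp_add]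
        congr 2
        have h3 : (1 + ε) ≠ 0 := by positivity
        have h4 : (1 - ε) ≠ 0 := by linarith
        have h5 : 1 - ε ^ 2 = (1 - ε) * (1 + ε) := by ring
        rw [hδ, h5]
        push_cast
        field_simp
        ring

theorem differentiable_fockFun (ε : ℝ) (n : ℕ) : Differentiable ℂ (fockFun ε n) := by
  unfold fockFun
  have : Differentiable ℂ fun z : ℂ => Polynomial.aeval z (hermiteH n) :=
    Polynomial.differentiable_aeval _
  fun_prop

/-- The functions `E_n` as elements of the Fock space. -/
def fockE {ε : ℝ} (h0 : 0 < ε) (h1 : ε < 1) (n : ℕ) : fockSpace ε :=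
  ⟨(memLp_fockFun h0 h1 n).toLp, fockFun ε n, differentiable_fockFun ε n, MemLp.coeFn_toLp _⟩

/-! ### Toeplitz operators -/

theorem memLp_top_fockMeasure (ε : ℝ) {φ : ℂ → ℂ} (hφ : MemLp φ ∞ (volume : Measure ℂ)) :
    MemLp φ ∞ (fockMeasure ε) := by
  refine ⟨hφ.1.mono_ac (fockMeasure_ac ε), ?_⟩
  have := hφ.2
  rw [eLpNorm_exponent_top] at this ⊢
  exact (eLpNormEssSup_mono_measure φ (fockMeasure_ac ε)).trans_lt this

/-- The Toeplitz operator `T_φ u = P (φ u)` on the Fock space with symbol `φ ∈ L^∞(ℂ)`, where `P`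
is the orthogonal projection of `L²(ℂ, μ_ε)` onto the Fock space. -/
def toeplitz (ε : ℝ) (φ : ℂ → ℂ) (hφ : MemLp φ ∞ (volume : Measure ℂ)) :
    fockSpace ε →L[ℂ] fockSpace ε :=
  (fockSpace ε).orthogonalProjectionOnto ∘L
    (ContinuousLinearMap.holderL (fockMeasure ε) ∞ 2 2 (ContinuousLinearMap.mul ℂ ℂ)
      ((memLp_top_fockMeasure ε hφ).toLp φ)) ∘L (fockSpace ε).subtypeL

/-! ### The heat operator and Weyl operators -/

/-- The heat solution operator `e^{tΔ}` on functions on `ℂ ≅ ℝ²`, `t > 0`. -/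
def heat (t : ℝ) (φ : ℂ → ℂ) (w : ℂ) : ℂ :=
  (1 / (4 * Real.pi * t) : ℝ) * ∫ z : ℂ, φ z * (Real.exp (-(‖z - w‖ ^ 2 / (4 * t))) : ℂ)

/-- The symbol `a(x,ξ) = (e^{(1-ε²)/(16ε) Δ} φ)((1+ε)/(2√ε) x - (1-ε)/(2√ε) i ξ)`. -/
def weylSymbol (ε : ℝ) (φ : ℂ → ℂ) (x ξ : ℝ) : ℂ :=
  heat ((1 - ε ^ 2) / (16 * ε)) φ
    (((1 + ε) / (2 * √ε) : ℝ) * (x : ℂ) - ((1 - ε) / (2 * √ε) : ℝ) * Complex.I * (ξ : ℂ))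

/-- The integrand `a((x+y)/2, ξ) e^{i(x-y)ξ} f(y)` of the Weyl operator. -/
def weylIntegrand (a : ℝ → ℝ → ℂ) (f : ℝ → ℂ) (x ξ y : ℝ) : ℂ :=
  a ((x + y) / 2) ξ * Complex.exp (Complex.I * ((x : ℂ) - y) * ξ) * f y

/-- The bounded operator `W` on `L²(ℝ)` is the Weyl operator `W_a` with symbol `a`: for every
Schwartz function `f` and all `x`, the iterated integral
`∫ (∫ a((x+y)/2, ξ) e^{i(x-y)ξ} f(y) dy) dξ/2π`
converges, and it is equal to `W f (x)` for almost all `x`. (The Schwartz functions being dense in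
`L²(ℝ)`, at most one bounded operator has this property; on the rest of `L²(ℝ)` it is `W_a` by
continuous extension.) -/
structure IsWeylOperator (a : ℝ → ℝ → ℂ)
    (W : Lp ℂ 2 (volume : Measure ℝ) →L[ℂ] Lp ℂ 2 (volume : Measure ℝ)) : Prop where
  integrable_inner : ∀ (f : 𝓢(ℝ, ℂ)) (x ξ : ℝ), Integrable (weylIntegrand a f x ξ)
  integrable_outer : ∀ (f : 𝓢(ℝ, ℂ)) (x : ℝ), Integrable fun ξ => ∫ y, weylIntegrand a f x ξ y
  eq_integral : ∀ f : 𝓢(ℝ, ℂ), W (f.toLp 2) =ᵐ[volume]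
    fun x => (1 / (2 * Real.pi) : ℝ) * ∫ ξ, ∫ y, weylIntegrand a f x ξ y

end HermiteFock

end

open HermiteFock

/-! The map V is an integral operator, Vf(z) = ∫ k(z,x) f(x) dx, with an explicit Gaussian kernel k
(`fockKernel`), and both halves of the theorem come out of Gaussian integrals of k.

Bases. The Hermite functions are orthonormal by integration by parts. They are complete because a
function orthogonal to all of them, multiplied by e^{-x²/2}, has vanishing moments and hence
vanishing Fourier transform. The E_n are orthonormal by integration by parts in the plane: for the
weight e^{γz² + γz̄² - β|z|²} with γ = ε²/(1-ε²) and β = 2ε/(1-ε²), the relation β² - 4γ² = 4γ makes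
the step H_n → H_{n+1} in z̄ dual to differentiation in z (`integral_planeGauss_hermiteH_succ`). The
kernel satisfies ∫ k(z,x) h_n(x) dx = E_n(z) (`inner_coherent_hermiteL2`), and the states conj
k(z,·) have the reproducing kernel K_w(z) = (β/π) e^{βzw̄} as their inner products
(`inner_coherent_coherent`). So each K_w is the sum of a series in the E_n (`hasSum_reproK`). A Fock
function orthogonal to all E_n is then orthogonal to all K_w, that is, zero at every point.

Operators. Pairing V* T_φ V with a test function shows that it is given by ∫ φ(z) k(z̄,x) k(z,y)
e^{-β|z|²} dz. With A = (1+ε)/(2√ε) and B = (1-ε)/(2√ε), the heat kernel at time (1-ε²)/(16ε) is a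
Gaussian of rate 1/(AB). Inserting it into the Weyl formula and integrating over ξ gives, for each
single z, exactly k(z̄,x) k(z,y) e^{-β|z|²} (`integral_weyl_gaussian`). This is the theorem for a
point mass at z, and superposition gives it for bounded φ.

Fubini needs care, since the integral over (ξ,y,z) does not converge absolutely in general. The
exchanges are made two variables at a time, and the decay in ξ appears only after the integration
over y, which produces a Gaussian windowed Fourier transform of f. Integrating by parts twice bounds
it by D(p)/(1+q²) with D integrable (`exists_norm_windowInt_le_decay`). -/

noncomputable section

namespace HermiteFock

/-! ### Hermite recurrences and integrals of Hermite polynomials against Gaussians -/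

open Polynomial in
theorem derivative_hermiteH_succ (n : ℕ) :
    derivative (hermiteH (n + 1)) = 2 * ((n : ℤ[X]) + 1) * hermiteH n := by
  induction n with
  | zero => simp [hermiteH]
  | succ n ih =>
    rw [show hermiteH (n + 1 + 1) = 2 * X * hermiteH (n + 1) - derivative (hermiteH (n + 1)) from rfl,
      ih]
    have h2 : derivative (2 * ((n : ℤ[X]) + 1) * hermiteH n)
        = 2 * ((n : ℤ[X]) + 1) * derivative (hermiteH n) := by
      simp
    have h3 : derivative (2 * X * hermiteH (n + 1))
        = 2 * hermiteH (n + 1) + 2 * X * derivative (hermiteH (n + 1)) := by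
      simp
    rw [map_sub, h2, h3, ih, hermiteH]
    push_cast
    ring

theorem hermiteH_succ_succ (n : ℕ) :
    hermiteH (n + 2) = 2 * Polynomial.X * hermiteH (n + 1)
      - 2 * ((n : Polynomial ℤ) + 1) * hermiteH n := by
  rw [← derivative_hermiteH_succ]
  rfl

/-- Half of the decay rate -Re b absorbs the polynomial through `aeval_bound`; the other half still
gives an integrable Gaussian. -/
theorem integrable_aeval_mul_cexp (p : Polynomial ℤ) {b : ℂ} (hb : b.re < 0) (c : ℂ) :
    Integrable fun x : ℝ => Polynomial.aeval (x : ℂ) p * Complex.exp (b * x ^ 2 + c * x) := by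
  obtain ⟨C, hC, h⟩ := aeval_bound p (-b.re / 2) (by linarith)
  have hb' : (b + (-b.re / 2 : ℝ)).re < 0 := by
    simp only [Complex.add_re, Complex.ofReal_re]; linarith
  have hi := ((integrable_cexp_quadratic' hb' c 0).norm).const_mul C
  have hc : Continuous fun x : ℝ => Polynomial.aeval (x : ℂ) p :=
    (Polynomial.continuous_aeval _).comp Complex.continuous_ofReal
  refine hi.mono' (by fun_prop) (ae_of_all _ fun x => ?_)
  rw [norm_mul, show (b + (-b.re / 2 : ℝ)) * (x : ℂ) ^ 2 + c * x + 0
    = ((-b.re / 2 * x ^ 2 : ℝ) : ℂ) + (b * x ^ 2 + c * x) by push_cast; ring,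
    Complex.exp_add (_ : ℂ) (_ + _), norm_mul, ← mul_assoc, Complex.norm_exp_ofReal]
  have := h x
  simp only [Complex.norm_real, Real.norm_eq_abs, sq_abs] at this
  gcongr

/-- Integration by parts against a complex Gaussian. -/
theorem integral_derivative_mul_cexp (p : Polynomial ℤ) {b : ℂ} (hb : b.re < 0) (c : ℂ) :
    (∫ x : ℝ, Polynomial.aeval (x : ℂ) (Polynomial.derivative p) * Complex.exp (b * x ^ 2 + c * x))
      + 2 * b * (∫ x : ℝ, Polynomial.aeval (x : ℂ) (Polynomial.X * p)
          * Complex.exp (b * x ^ 2 + c * x))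
      + c * ∫ x : ℝ, Polynomial.aeval (x : ℂ) p * Complex.exp (b * x ^ 2 + c * x) = 0 := by
  have i1 := integrable_aeval_mul_cexp (Polynomial.derivative p) hb c
  have i2 := integrable_aeval_mul_cexp (Polynomial.X * p) hb c
  have i3 := integrable_aeval_mul_cexp p hb c
  have i4 := i1.add (i2.const_mul (2 * b))
  simp only [Pi.add_def] at i4
  rw [← integral_const_mul, ← integral_const_mul, ← integral_add i1 (i2.const_mul _),
    ← integral_add i4 (i3.const_mul _)]
  -- The combined integrand is the derivative of p(x) e^{bx² + cx}.
  refine integral_eq_zero_of_hasDerivAt_of_integrable (fun x => ?_)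
    (i4.add (i3.const_mul _)) i3
  have h1 : HasDerivAt (fun z : ℂ => Polynomial.aeval z p)
      (Polynomial.aeval (x : ℂ) (Polynomial.derivative p)) (x : ℂ) :=
    Polynomial.hasDerivAt_aeval _ _
  have h2 : HasDerivAt (fun z : ℂ => Complex.exp (b * z ^ 2 + c * z))
      (Complex.exp (b * x ^ 2 + c * x) * (b * (2 * x) + c)) (x : ℂ) := by
    have h := ((((hasDerivAt_id (x : ℂ)).pow 2).const_mul b).add
      ((hasDerivAt_id (x : ℂ)).const_mul c)).cexp
    simpa using h
  refine ((h1.mul h2).comp_ofReal).congr_deriv ?_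
  simp only [map_mul, Polynomial.aeval_X]
  ring

/-- Integration by parts for H_{n+1}, where H_{n+1}' = 2(n+1) H_n and the factor x is eliminated by
2x H_{n+1} = H_{n+2} + 2(n+1) H_n. The result is again a recurrence of Hermite type, so Gaussian
integrals of Hermite polynomials are rescaled Hermite polynomials in c. -/
theorem integral_hermiteH_mul_cexp_rec {b : ℂ} (hb : b.re < 0) (c : ℂ) (n : ℕ) :
    -b * (∫ x : ℝ, Polynomial.aeval (x : ℂ) (hermiteH (n + 2)) * Complex.exp (b * x ^ 2 + c * x))
      = 2 * (n + 1) * (1 + b) * (∫ x : ℝ, Polynomial.aeval (x : ℂ) (hermiteH n)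
          * Complex.exp (b * x ^ 2 + c * x))
        + c * ∫ x : ℝ, Polynomial.aeval (x : ℂ) (hermiteH (n + 1))
          * Complex.exp (b * x ^ 2 + c * x) := by
  have h := integral_derivative_mul_cexp (hermiteH (n + 1)) hb c
  have e : ∫ x : ℝ, Polynomial.aeval (x : ℂ) (hermiteH (n + 2)) * Complex.exp (b * x ^ 2 + c * x)
      = 2 * (∫ x : ℝ, Polynomial.aeval (x : ℂ) (Polynomial.X * hermiteH (n + 1))
          * Complex.exp (b * x ^ 2 + c * x))
        - 2 * (n + 1) * (∫ x : ℝ, Polynomial.aeval (x : ℂ) (hermiteH n)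
          * Complex.exp (b * x ^ 2 + c * x)) := by
    rw [← integral_const_mul, ← integral_const_mul, ← integral_sub
      ((integrable_aeval_mul_cexp _ hb c).const_mul _)
      ((integrable_aeval_mul_cexp _ hb c).const_mul _)]
    refine integral_congr_ae (ae_of_all _ fun x => ?_)
    simp only [hermiteH_succ_succ, map_sub, map_mul, map_add, Polynomial.aeval_X, map_ofNat,
      map_natCast, map_one]
    ring
  have e' : ∫ x : ℝ, Polynomial.aeval (x : ℂ) (Polynomial.derivative (hermiteH (n + 1)))
        * Complex.exp (b * x ^ 2 + c * x)
      = 2 * (n + 1) * ∫ x : ℝ, Polynomial.aeval (x : ℂ) (hermiteH n)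
          * Complex.exp (b * x ^ 2 + c * x) := by
    rw [← integral_const_mul]
    refine integral_congr_ae (ae_of_all _ fun x => ?_)
    simp only [derivative_hermiteH_succ, map_mul, map_add, map_ofNat, map_natCast, map_one]
    ring
  rw [e'] at h
  rw [e]
  linear_combination (-1 : ℂ) * h

theorem integral_hermiteH_one_mul_cexp {b : ℂ} (hb : b.re < 0) (c : ℂ) :
    -b * (∫ x : ℝ, Polynomial.aeval (x : ℂ) (hermiteH 1) * Complex.exp (b * x ^ 2 + c * x))
      = c * ∫ x : ℝ, Polynomial.aeval (x : ℂ) (hermiteH 0) * Complex.exp (b * x ^ 2 + c * x) := by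
  have h := integral_derivative_mul_cexp (hermiteH 0) hb c
  have e : ∫ x : ℝ, Polynomial.aeval (x : ℂ) (hermiteH 1) * Complex.exp (b * x ^ 2 + c * x)
      = 2 * (∫ x : ℝ, Polynomial.aeval (x : ℂ) (Polynomial.X * hermiteH 0)
          * Complex.exp (b * x ^ 2 + c * x)) := by
    rw [← integral_const_mul]
    refine integral_congr_ae (ae_of_all _ fun x => ?_)
    simp [hermiteH, map_ofNat]
    ring
  have e' : ∫ x : ℝ, Polynomial.aeval (x : ℂ) (Polynomial.derivative (hermiteH 0))
        * Complex.exp (b * x ^ 2 + c * x) = 0 := by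
    simp [hermiteH]
  rw [e'] at h
  rw [e]
  linear_combination (-1 : ℂ) * h

/-! ### Orthonormality of the Hermite functions -/

/-- For the weight e^{-x²} the raising operator 2x - d/dx is adjoint to d/dx. The exponent is
written `-1 * x ^ 2 + 0 * x` to fit the general form bx² + cx. -/
theorem integral_hermiteH_mul_hermiteH_succ (m n : ℕ) :
    (∫ x : ℝ, Polynomial.aeval (x : ℂ) (hermiteH m * hermiteH (n + 1))
        * Complex.exp (-1 * x ^ 2 + 0 * x))
      = ∫ x : ℝ, Polynomial.aeval (x : ℂ) (Polynomial.derivative (hermiteH m) * hermiteH n)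
        * Complex.exp (-1 * x ^ 2 + 0 * x) := by
  have hb : (-1 : ℂ).re < 0 := by simp
  have h := integral_derivative_mul_cexp (hermiteH m * hermiteH n) hb 0
  rw [zero_mul, add_zero, ← integral_const_mul, ← integral_add (integrable_aeval_mul_cexp _ hb 0)
    ((integrable_aeval_mul_cexp _ hb 0).const_mul _)] at h
  rw [← sub_eq_zero, ← integral_sub (integrable_aeval_mul_cexp _ hb 0)
    (integrable_aeval_mul_cexp _ hb 0), ← neg_eq_zero, ← integral_neg]
  refine Eq.trans (integral_congr_ae (ae_of_all _ fun x => ?_)) h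
  simp only [hermiteH, Polynomial.derivative_mul, map_sub, map_mul, map_add, Polynomial.aeval_X,
    map_ofNat]
  ring

theorem integral_hermiteH_mul_hermiteH (m n : ℕ) :
    (∫ x : ℝ, Polynomial.aeval (x : ℂ) (hermiteH m * hermiteH n)
        * Complex.exp (-1 * x ^ 2 + 0 * x))
      = if m = n then (n.factorial * 2 ^ n * √Real.pi : ℝ) else 0 := by
  induction n generalizing m with
  | zero =>
    cases m with
    | zero =>
      have := integral_cexp_quadratic (b := -1) (by simp) 0 0
      simp only [neg_neg, add_zero] at this
      simp only [hermiteH, mul_one, map_one, one_mul, this]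
      simp [Real.sqrt_eq_rpow, Complex.ofReal_cpow Real.pi_pos.le]
    | succ m =>
      rw [mul_comm, integral_hermiteH_mul_hermiteH_succ]
      simp [hermiteH]
  | succ n ih =>
    rw [integral_hermiteH_mul_hermiteH_succ]
    cases m with
    | zero => simp [hermiteH]
    | succ m =>
      have e : ∀ x : ℝ, Polynomial.aeval (x : ℂ) (Polynomial.derivative (hermiteH (m + 1)) * hermiteH n)
          * Complex.exp (-1 * x ^ 2 + 0 * x) = 2 * (m + 1) *
          (Polynomial.aeval (x : ℂ) (hermiteH m * hermiteH n)
            * Complex.exp (-1 * x ^ 2 + 0 * x)) := by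
        intro x
        simp only [derivative_hermiteH_succ, map_mul, map_add, map_ofNat, map_natCast, map_one]
        ring
      simp only [e]
      rw [integral_const_mul, ih]
      by_cases h : m = n
      · subst h
        simp [Nat.factorial_succ]
        ring
      · simp [h]

theorem hermiteFun_eq (n : ℕ) (x : ℝ) : hermiteFun n x =
    ((√(n.factorial * 2 ^ n * √Real.pi))⁻¹ : ℝ) * (Polynomial.aeval (x : ℂ) (hermiteH n)
      * Complex.exp (-(1 / 2) * x ^ 2 + 0 * x)) := by
  rw [hermiteFun, mul_assoc]
  congr 3
  ring

theorem conj_aeval (p : Polynomial ℤ) (z : ℂ) :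
    (starRingEnd ℂ) (Polynomial.aeval z p) = Polynomial.aeval ((starRingEnd ℂ) z) p := by
  exact (Polynomial.aeval_algHom_apply ((starRingEnd ℂ).toIntAlgHom) z p).symm

theorem conj_hermiteFun (n : ℕ) (x : ℝ) :
    (starRingEnd ℂ) (hermiteFun n x) = hermiteFun n x := by
  simp [hermiteFun, conj_aeval, ← Complex.exp_conj, map_ofNat]

theorem orthonormal_hermiteL2 : Orthonormal ℂ hermiteL2 := by
  rw [orthonormal_iff_ite]
  intro m n
  rw [L2.inner_def]
  have e : ∀ᵐ x : ℝ, inner ℂ (hermiteL2 m x) (hermiteL2 n x)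
      = (((√(n.factorial * 2 ^ n * √Real.pi))⁻¹ * (√(m.factorial * 2 ^ m * √Real.pi))⁻¹ : ℝ) : ℂ) *
        (Polynomial.aeval (x : ℂ) (hermiteH m * hermiteH n)
          * Complex.exp (-1 * x ^ 2 + 0 * x)) := by
    filter_upwards [(memLp_hermiteFun m).coeFn_toLp, (memLp_hermiteFun n).coeFn_toLp] with x h1 h2
    rw [hermiteL2, hermiteL2, h1, h2, RCLike.inner_apply, conj_hermiteFun, hermiteFun_eq,
      hermiteFun_eq, show (-1 * (x : ℂ) ^ 2 + 0 * x) = (-(1 / 2) * (x : ℂ) ^ 2 + 0 * x)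
        + (-(1 / 2) * (x : ℂ) ^ 2 + 0 * x) by ring, Complex.exp_add (_ + _) (_ + _), map_mul]
    push_cast
    ring
  rw [integral_congr_ae e, integral_const_mul, integral_hermiteH_mul_hermiteH]
  by_cases h : m = n
  · subst h
    rw [if_pos rfl, if_pos rfl, ← Complex.ofReal_mul, ← Complex.ofReal_one]
    congr 1
    rw [← mul_inv, Real.mul_self_sqrt (by positivity), inv_mul_cancel₀ (by positivity)]
  · simp [h]

/-! ### Completeness of the Hermite functions -/

/-- An integrable function on the line whose Fourier transform vanishes is zero almost
everywhere. -/
theorem ae_eq_zero_of_fourier_eq_zero {g : ℝ → ℂ} (hg : Integrable g)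
    (h : ∀ t : ℝ, ∫ x : ℝ, Complex.exp (Complex.I * t * x) * g x = 0) : g =ᵐ[volume] 0 := by
  refine ae_eq_zero_of_integral_contDiff_smul_eq_zero hg.locallyIntegrable fun u hu hus => ?_
  have hus' : HasCompactSupport fun x => (u x : ℂ) :=
    hus.comp_left (g := fun t : ℝ => (t : ℂ)) (by simp)
  set w : 𝓢(ℝ, ℂ) := hus'.toSchwartzMap (Complex.ofRealCLM.contDiff.comp hu) with hw
  set v : 𝓢(ℝ, ℂ) := FourierTransformInv.fourierInv w with hv
  have hvw : FourierTransform.fourier v = w := FourierTransform.fourier_fourierInv_eq w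
  -- The test function u is the Fourier transform of a Schwartz function v, so ∫ u g = ∫ v ĝ = 0.
  have key := VectorFourier.integral_fourierIntegral_smul_eq_flip (L := innerₗ ℝ) (μ := volume)
    (ν := volume) (f := (v : ℝ → ℂ)) (g := g) Real.continuous_fourierChar
    (by exact continuous_inner) v.integrable hg
  have e1 : ∀ x, VectorFourier.fourierIntegral Real.fourierChar volume (innerₗ ℝ) v x
      = (u x : ℂ) := by
    intro x
    have : (FourierTransform.fourier v) x = w x := by rw [hvw]
    exact this
  have e2 : ∀ x, VectorFourier.fourierIntegral Real.fourierChar volume (innerₗ ℝ).flip g x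
      = 0 := by
    intro t
    rw [← h (-2 * Real.pi * t)]
    simp only [VectorFourier.fourierIntegral, LinearMap.flip_apply, innerₗ_apply_apply,
      Circle.smul_def, Real.fourierChar_apply, smul_eq_mul]
    refine integral_congr_ae (ae_of_all _ fun x => ?_)
    simp only [RCLike.inner_apply, conj_trivial]
    congr 2
    push_cast
    ring
  simp only [e1, e2, smul_zero, integral_zero] at key
  simpa using key

theorem memLp_aeval_mul_cexp (p : Polynomial ℤ) {b : ℂ} (hb : b.re < 0) (c : ℂ) :
    MemLp (fun x : ℝ => Polynomial.aeval (x : ℂ) p * Complex.exp (b * x ^ 2 + c * x)) 2 volume := by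
  have hc : Continuous fun x : ℝ => Polynomial.aeval (x : ℂ) p :=
    (Polynomial.continuous_aeval _).comp Complex.continuous_ofReal
  rw [memLp_two_iff_integrable_sq_norm (by fun_prop)]
  have hb2 : (2 * b).re < 0 := by
    rw [show (2 * b).re = 2 * b.re by simp]; linarith
  refine (integrable_aeval_mul_cexp (p * p) hb2 (2 * c)).norm.congr (ae_of_all _ fun x => ?_)
  simp only [← norm_pow]
  rw [show 2 * b * (x : ℂ) ^ 2 + 2 * c * x = (b * x ^ 2 + c * x) + (b * x ^ 2 + c * x) by ring,
    Complex.exp_add (_ + _) (_ + _), map_mul]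
  congr 1
  ring

theorem integrable_aeval_mul_cexp_mul (p : Polynomial ℤ) {b : ℂ} (hb : b.re < 0) (c : ℂ)
    (f : Lp ℂ 2 (volume : Measure ℝ)) :
    Integrable fun x : ℝ => Polynomial.aeval (x : ℂ) p * Complex.exp (b * x ^ 2 + c * x) * f x :=
  (memLp_aeval_mul_cexp p hb c).integrable_mul (Lp.memLp f)

theorem inner_hermiteL2 (n : ℕ) (f : Lp ℂ 2 (volume : Measure ℝ)) :
    inner ℂ (hermiteL2 n) f = ∫ x, hermiteFun n x * f x := by
  rw [L2.inner_def]
  refine integral_congr_ae ?_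
  filter_upwards [(memLp_hermiteFun n).coeFn_toLp] with x h1
  rw [hermiteL2, h1, RCLike.inner_apply, conj_hermiteFun, mul_comm]

/-- Multiplication by x keeps the span of the Hermite polynomials: x H_0 = H_1/2 and x H_{n+1} =
H_{n+2}/2 + (n+1) H_n. Induction on the power of x thus reduces everything to the orthogonality to
each h_n. -/
theorem integral_pow_mul_eq_zero {f : Lp ℂ 2 (volume : Measure ℝ)}
    (hf : ∀ n, inner ℂ (hermiteL2 n) f = 0) (m n : ℕ) :
    ∫ x : ℝ, Polynomial.aeval (x : ℂ) (Polynomial.X ^ m * hermiteH n)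
      * Complex.exp (-(1 / 2) * x ^ 2 + 0 * x) * f x = 0 := by
  have hb : (-(1 / 2) : ℂ).re < 0 := by norm_num
  induction m generalizing n with
  | zero =>
    have h := hf n
    rw [inner_hermiteL2] at h
    simp only [hermiteFun_eq, mul_assoc] at h
    rw [integral_const_mul, mul_eq_zero] at h
    rcases h with h | h
    · exfalso
      rw [Complex.ofReal_eq_zero] at h
      exact absurd h (by positivity)
    · simpa [mul_assoc] using h
  | succ m ih =>
    have e : ∀ k, (∫ x : ℝ, Polynomial.aeval (x : ℂ) (Polynomial.X ^ m * hermiteH k)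
      * Complex.exp (-(1 / 2) * x ^ 2 + 0 * x) * f x) = 0 := ih
    cases n with
    | zero =>
      have h : (1 / 2 : ℂ) * (∫ x : ℝ, Polynomial.aeval (x : ℂ) (Polynomial.X ^ m * hermiteH 1)
        * Complex.exp (-(1 / 2) * x ^ 2 + 0 * x) * f x) = 0 := by
        rw [ih, mul_zero]
      rw [← integral_const_mul] at h
      refine Eq.trans (integral_congr_ae (ae_of_all _ fun x => ?_)) h
      simp [hermiteH, map_ofNat, pow_succ]
      ring
    | succ n =>
      have h : (1 / 2 : ℂ) * (∫ x : ℝ, Polynomial.aeval (x : ℂ) (Polynomial.X ^ m * hermiteH (n + 2))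
        * Complex.exp (-(1 / 2) * x ^ 2 + 0 * x) * f x) + (n + 1) *
        (∫ x : ℝ, Polynomial.aeval (x : ℂ) (Polynomial.X ^ m * hermiteH n)
        * Complex.exp (-(1 / 2) * x ^ 2 + 0 * x) * f x) = 0 := by
        rw [ih, ih]; simp
      rw [← integral_const_mul, ← integral_const_mul, ← integral_add
        ((integrable_aeval_mul_cexp_mul _ hb 0 f).const_mul _)
        ((integrable_aeval_mul_cexp_mul _ hb 0 f).const_mul _)] at h
      refine Eq.trans (integral_congr_ae (ae_of_all _ fun x => ?_)) h
      simp only [hermiteH_succ_succ, map_mul, map_sub, map_add, map_ofNat, map_natCast, map_one,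
        map_pow, Polynomial.aeval_X]
      ring

/-- All moments of g = e^{-x²/2} f vanish, and g is integrable against every exponential. So the
exponential series may be integrated termwise against g, and the Fourier transform of g is zero. -/
theorem eq_zero_of_inner_hermiteL2_eq_zero {f : Lp ℂ 2 (volume : Measure ℝ)}
    (hf : ∀ n, inner ℂ (hermiteL2 n) f = 0) : f = 0 := by
  have hb : (-(1 / 2) : ℂ).re < 0 := by norm_num
  set g : ℝ → ℂ := fun x => Complex.exp (-(1 / 2) * x ^ 2 + 0 * x) * f x with hg
  have hint : ∀ c : ℂ, Integrable fun x : ℝ => Complex.exp (-(1 / 2) * x ^ 2 + c * x) * f x := by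
    intro c
    simpa using integrable_aeval_mul_cexp_mul 1 hb c f
  have key : g =ᵐ[volume] 0 := by
    refine ae_eq_zero_of_fourier_eq_zero (hint 0) fun t => ?_
    have hs : HasSum (fun m : ℕ => ∫ x : ℝ, (Complex.I * t * x) ^ m / m.factorial * g x)
        (∫ x : ℝ, Complex.exp (Complex.I * t * x) * g x) := by
      refine hasSum_integral_of_dominated_convergence
        (fun m x => |t * x| ^ m / m.factorial * ‖g x‖) (fun m => ?_) (fun m => ?_) ?_ ?_ ?_
      · exact AEStronglyMeasurable.mul (by fun_prop) (hint 0).aestronglyMeasurable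
      · refine ae_of_all _ fun x => ?_
        simp [abs_mul, mul_assoc]
      · exact ae_of_all _ fun x => (Real.summable_pow_div_factorial _).mul_right _
      · have e : ∀ x : ℝ, ∑' m : ℕ, |t * x| ^ m / m.factorial * ‖g x‖
            = Real.exp |t * x| * ‖g x‖ := by
          intro x
          rw [tsum_mul_right, Real.exp_eq_exp_ℝ, NormedSpace.exp_eq_tsum_div]
        simp only [e]
        -- The dominating function is e^{|tx|}|g| ≤ (e^{tx} + e^{-tx})|g|.
        have h3 := (hint t).norm.add (hint (-t)).norm
        refine h3.mono' (AEStronglyMeasurable.mul (by fun_prop)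
          (hint 0).aestronglyMeasurable.norm) (ae_of_all _ fun x => ?_)
        have e1 : ∀ s : ℝ, ‖Complex.exp (-(1 / 2) * x ^ 2 + s * x) * f x‖
            = Real.exp (s * x) * ‖g x‖ := by
          intro s
          rw [hg, norm_mul, norm_mul, Complex.exp_add, norm_mul, zero_mul, add_zero,
            ← Complex.ofReal_mul, Complex.norm_exp_ofReal]
          ring
        have e2 := e1 (-t)
        push_cast at e2
        simp only [Pi.add_apply]
        rw [e1, e2, norm_mul, Real.norm_of_nonneg (Real.exp_pos _).le, norm_norm, ← add_mul]
        refine mul_le_mul_of_nonneg_right ?_ (norm_nonneg _)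
        rcases abs_cases (t * x) with ⟨h, -⟩ | ⟨h, -⟩
        · rw [h]; linarith [Real.exp_pos (-t * x)]
        · rw [h, neg_mul]; linarith [Real.exp_pos (t * x)]
      · refine ae_of_all _ fun x => ?_
        have := NormedSpace.expSeries_div_hasSum_exp (𝔸 := ℂ) (Complex.I * t * x)
        rw [← Complex.exp_eq_exp_ℂ] at this
        exact this.mul_right _
    have hz : ∀ m : ℕ, ∫ x : ℝ, (Complex.I * t * x) ^ m / m.factorial * g x = 0 := by
      intro m
      rw [← mul_zero ((Complex.I * t) ^ m / m.factorial), ← integral_pow_mul_eq_zero hf m 0,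
        ← integral_const_mul]
      refine integral_congr_ae (ae_of_all _ fun x => ?_)
      simp only [hg, hermiteH, mul_one, map_pow, Polynomial.aeval_X, mul_pow]
      ring
    simp only [hz] at hs
    exact hs.unique hasSum_zero
  refine (Lp.eq_zero_iff_ae_eq_zero).2 ?_
  filter_upwards [key] with x hx
  simpa [hg, Complex.exp_ne_zero] using hx

/-- The Hermite functions as a Hilbert basis of `L²(ℝ)`. -/
def hermiteBasis : HilbertBasis ℕ ℂ (Lp ℂ 2 (volume : Measure ℝ)) :=
  HilbertBasis.mkOfOrthogonalEqBot orthonormal_hermiteL2 (by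
    rw [Submodule.eq_bot_iff]
    intro f hf
    refine eq_zero_of_inner_hermiteL2_eq_zero fun n => ?_
    exact (Submodule.mem_orthogonal _ _).1 hf _ (Submodule.subset_span ⟨n, rfl⟩))

theorem coe_hermiteBasis : ⇑hermiteBasis = hermiteL2 :=
  HilbertBasis.coe_mkOfOrthogonalEqBot _ _

/-! ### Gaussian integrals over the complex plane -/

/-- The function `p(z) q(z̄) e^{γ z² + γ z̄² - β |z|²}`. -/
def planeGauss (γ β : ℝ) (p q : Polynomial ℤ) (z : ℂ) : ℂ :=
  Polynomial.aeval z p * Polynomial.aeval ((starRingEnd ℂ) z) q *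
    Complex.exp (γ * z ^ 2 + γ * (starRingEnd ℂ) z ^ 2 - β * z * (starRingEnd ℂ) z)

theorem integrable_exp_neg_mul_sq_norm {b : ℝ} (hb : 0 < b) :
    Integrable fun z : ℂ => Real.exp (-(b * ‖z‖ ^ 2)) := by
  refine ((GaussianFourier.integrable_cexp_neg_mul_sq_norm_add (V := ℂ) (b := b)
      (by simpa using hb) 0 0).norm).congr (ae_of_all _ fun z => ?_)
  simp only [Complex.norm_exp]
  congr 1
  simp [← Complex.ofReal_pow]

/-- The exponent is real, 2γ(x² - y²) - β(x² + y²) ≤ -δ|z|² with δ = β - 2γ. Each of the two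
polynomials costs a quarter of δ, which leaves half of it. -/
theorem integrable_planeGauss {γ β : ℝ} (hγ : 0 ≤ γ) (hβ : 2 * γ < β) (p q : Polynomial ℤ) :
    Integrable (planeGauss γ β p q) := by
  set δ := β - 2 * γ with hδ
  have hδ0 : 0 < δ := by linarith
  obtain ⟨C, hC, h1⟩ := aeval_bound p (δ / 4) (by positivity)
  obtain ⟨D, hD, h2⟩ := aeval_bound q (δ / 4) (by positivity)
  have c1 : Continuous fun z : ℂ => Polynomial.aeval z p := Polynomial.continuous_aeval _
  have c2 : Continuous fun z : ℂ => Polynomial.aeval ((starRingEnd ℂ) z) q :=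
    (Polynomial.continuous_aeval _).comp Complex.continuous_conj
  have c3 : Continuous fun z : ℂ => (starRingEnd ℂ) z := Complex.continuous_conj
  refine ((integrable_exp_neg_mul_sq_norm (b := δ / 2) (by positivity)).const_mul (C * D)).mono'
    (by unfold planeGauss; fun_prop) (ae_of_all _ fun z => ?_)
  have h2' := h2 ((starRingEnd ℂ) z)
  rw [RCLike.norm_conj] at h2'
  have h3 : ‖Complex.exp (γ * z ^ 2 + γ * (starRingEnd ℂ) z ^ 2 - β * z * (starRingEnd ℂ) z)‖
      ≤ Real.exp (-(δ * ‖z‖ ^ 2)) := by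
    rw [Complex.norm_exp]
    refine Real.exp_le_exp.2 ?_
    have e : (γ * z ^ 2 + γ * (starRingEnd ℂ) z ^ 2 - β * z * (starRingEnd ℂ) z : ℂ)
        = ((2 * γ * (z.re ^ 2 - z.im ^ 2) - β * (z.re ^ 2 + z.im ^ 2) : ℝ) : ℂ) := by
      apply Complex.ext <;> simp [sq] <;> ring
    rw [e, Complex.ofReal_re, Complex.sq_norm, Complex.normSq_apply, hδ]
    nlinarith [mul_nonneg hγ (sq_nonneg z.im)]
  rw [planeGauss, norm_mul, norm_mul]
  calc _ ≤ (C * Real.exp (δ / 4 * ‖z‖ ^ 2)) * (D * Real.exp (δ / 4 * ‖z‖ ^ 2))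
        * Real.exp (-(δ * ‖z‖ ^ 2)) := by
        gcongr
        exact h1 z
    _ = C * D * (Real.exp (δ / 4 * ‖z‖ ^ 2) * Real.exp (δ / 4 * ‖z‖ ^ 2)
        * Real.exp (-(δ * ‖z‖ ^ 2))) := by ring
    _ = _ := by
      rw [← Real.exp_add, ← Real.exp_add]
      congr 2
      ring

/-- The derivative in the direction v is v ∂_z + v̄ ∂_z̄. It is computed by treating z + tv and z̄ +
tv̄ as functions of a complex t, then restricting to real t. -/
theorem hasDerivAt_planeGauss_line (γ β : ℝ) (p q : Polynomial ℤ) (z v : ℂ) :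
    HasLineDerivAt ℝ (planeGauss γ β p q)
      (v * (planeGauss γ β (Polynomial.derivative p) q z
          + 2 * γ * planeGauss γ β (Polynomial.X * p) q z
          - β * planeGauss γ β p (Polynomial.X * q) z)
        + (starRingEnd ℂ) v * (planeGauss γ β p (Polynomial.derivative q) z
          + 2 * γ * planeGauss γ β p (Polynomial.X * q) z
          - β * planeGauss γ β (Polynomial.X * p) q z)) z v := by
  set w := (starRingEnd ℂ) z
  set u := (starRingEnd ℂ) v
  have l1 : HasDerivAt (fun t : ℂ => z + t * v) v 0 := by
    simpa using ((hasDerivAt_id (0 : ℂ)).mul_const v).const_add z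
  have l2 : HasDerivAt (fun t : ℂ => w + t * u) u 0 := by
    simpa using ((hasDerivAt_id (0 : ℂ)).mul_const u).const_add w
  have p1 : HasDerivAt (fun t : ℂ => Polynomial.aeval (z + t * v) p)
      (Polynomial.aeval z (Polynomial.derivative p) * v) 0 := by
    have := (Polynomial.hasDerivAt_aeval p (z + 0 * v)).comp (0 : ℂ) l1
    simpa [Function.comp_def] using this
  have p2 : HasDerivAt (fun t : ℂ => Polynomial.aeval (w + t * u) q)
      (Polynomial.aeval w (Polynomial.derivative q) * u) 0 := by
    have := (Polynomial.hasDerivAt_aeval q (w + 0 * u)).comp (0 : ℂ) l2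
    simpa [Function.comp_def] using this
  have p3 : HasDerivAt (fun t : ℂ => Complex.exp (γ * (z + t * v) ^ 2 + γ * (w + t * u) ^ 2
      - β * ((z + t * v) * (w + t * u))))
      (Complex.exp (γ * z ^ 2 + γ * w ^ 2 - β * (z * w)) *
        (γ * (2 * z * v) + γ * (2 * w * u) - β * (v * w + z * u))) 0 := by
    have := ((((l1.pow 2).const_mul (γ : ℂ)).add ((l2.pow 2).const_mul (γ : ℂ))).sub
      ((l1.mul l2).const_mul (β : ℂ))).cexp
    simpa [Function.comp_def] using this
  have h := ((p1.mul p2).mul p3)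
  rw [← Complex.ofReal_zero] at h
  have h' := h.comp_ofReal
  rw [HasLineDerivAt]
  refine (h'.congr_deriv ?_).congr_of_eventuallyEq (Eventually.of_forall fun t => ?_)
  · simp only [planeGauss, map_mul, Polynomial.aeval_X, Complex.ofReal_zero, zero_mul, add_zero,
      Pi.mul_apply, mul_assoc, w, u]
    ring
  · simp only [planeGauss, map_add, Complex.real_smul, map_mul, Complex.conj_ofReal, Pi.mul_apply,
      mul_assoc, w, u]

/-- Integration by parts against the constant function 1: the directional derivative has integral
zero. -/
theorem integral_lineDeriv_planeGauss {γ β : ℝ} (hγ : 0 ≤ γ) (hβ : 2 * γ < β)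
    (p q : Polynomial ℤ) (v : ℂ) :
    v * ((∫ z, planeGauss γ β (Polynomial.derivative p) q z)
          + 2 * γ * (∫ z, planeGauss γ β (Polynomial.X * p) q z)
          - β * ∫ z, planeGauss γ β p (Polynomial.X * q) z)
        + (starRingEnd ℂ) v * ((∫ z, planeGauss γ β p (Polynomial.derivative q) z)
          + 2 * γ * (∫ z, planeGauss γ β p (Polynomial.X * q) z)
          - β * ∫ z, planeGauss γ β (Polynomial.X * p) q z) = 0 := by
  have i := fun p q => integrable_planeGauss hγ hβ p q
  have i1 := ((i (Polynomial.derivative p) q).add ((i (Polynomial.X * p) q).const_mul (2 * γ))).sub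
    ((i p (Polynomial.X * q)).const_mul (β : ℂ))
  have i2 := ((i p (Polynomial.derivative q)).add ((i p (Polynomial.X * q)).const_mul (2 * γ))).sub
    ((i (Polynomial.X * p) q).const_mul (β : ℂ))
  have i3 := (i1.const_mul v).add (i2.const_mul ((starRingEnd ℂ) v))
  simp only [Pi.add_def, Pi.sub_def] at i3
  have key := integral_bilinear_hasLineDerivAt_right_eq_neg_left_of_integrable
    (μ := (volume : Measure ℂ)) (f := fun _ => (1 : ℂ)) (f' := fun _ => (0 : ℂ))
    (B := ContinuousLinearMap.mul ℝ ℂ) (v := v) (g := planeGauss γ β p q)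
    (by simp) (by simpa using i3)
    (by simpa using i p q) (fun x _ => by
      rw [HasLineDerivAt]; exact hasDerivAt_const _ _)
    (fun x _ => hasDerivAt_planeGauss_line γ β p q x v)
  simp only [ContinuousLinearMap.mul_apply', one_mul, zero_mul, integral_zero, neg_zero] at key
  rw [← key]
  have i1a := ((i (Polynomial.derivative p) q).add ((i (Polynomial.X * p) q).const_mul (2 * γ)))
  have i2a := ((i p (Polynomial.derivative q)).add ((i p (Polynomial.X * q)).const_mul (2 * γ)))
  simp only [Pi.add_def, Pi.sub_def] at i1 i2 i1a i2a
  rw [integral_add (i1.const_mul v) (i2.const_mul _), integral_const_mul, integral_const_mul,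
    integral_sub i1a ((i p (Polynomial.X * q)).const_mul (β : ℂ)),
    integral_sub i2a ((i (Polynomial.X * p) q).const_mul (β : ℂ)),
    integral_add (i _ _) ((i _ _).const_mul _), integral_add (i _ _) ((i _ _).const_mul _)]
  simp only [integral_const_mul]

/-- The integrals of the z-derivative and of the z̄-derivative vanish separately. Eliminating the
term with z p from these two relations leaves the coefficient β² - 4γ² on the term with z̄ H_n(z̄);
the relation β² - 4γ² = 4γ turns this combination into the recursion H_{n+1} = 2X H_n - H_n'. -/
theorem integral_planeGauss_hermiteH_succ {γ β : ℝ} (hγ : 0 < γ) (hβ : 2 * γ < β)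
    (h : β ^ 2 - 4 * γ ^ 2 = 4 * γ) (p : Polynomial ℤ) (n : ℕ) :
    2 * γ * ∫ z, planeGauss γ β p (hermiteH (n + 1)) z
      = β * ∫ z, planeGauss γ β (Polynomial.derivative p) (hermiteH n) z := by
  have h1 := integral_lineDeriv_planeGauss hγ.le hβ p (hermiteH n) 1
  have h2 := integral_lineDeriv_planeGauss hγ.le hβ p (hermiteH n) Complex.I
  rw [map_one] at h1
  rw [Complex.conj_I] at h2
  have i := fun p q => integrable_planeGauss hγ.le hβ p q
  have e : ∫ z, planeGauss γ β p (hermiteH (n + 1)) z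
      = 2 * (∫ z, planeGauss γ β p (Polynomial.X * hermiteH n) z)
        - ∫ z, planeGauss γ β p (Polynomial.derivative (hermiteH n)) z := by
    rw [← integral_const_mul, ← integral_sub ((i _ _).const_mul _) (i _ _)]
    refine integral_congr_ae (ae_of_all _ fun z => ?_)
    simp only [planeGauss, hermiteH, map_sub, map_mul, Polynomial.aeval_X, map_ofNat]
    ring
  have h' : (β : ℂ) ^ 2 - 4 * γ ^ 2 = 4 * γ := by exact_mod_cast h
  rw [e]
  generalize (∫ z, planeGauss γ β p (Polynomial.X * hermiteH n) z) = a at *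
  generalize (∫ z, planeGauss γ β p (Polynomial.derivative (hermiteH n)) z) = b at *
  generalize (∫ z, planeGauss γ β (Polynomial.derivative p) (hermiteH n) z) = c at *
  generalize (∫ z, planeGauss γ β (Polynomial.X * p) (hermiteH n) z) = d at *
  -- The direction 1 gives the sum of the two relations and the direction i gives i times their
  -- difference.
  have h3 : c + 2 * γ * d - β * a = 0 := by
    linear_combination (1 / 2 : ℂ) * h1 - (Complex.I / 2) * h2
      + (1 / 2 : ℂ) * ((c + 2 * γ * d - β * a) - (b + 2 * γ * a - β * d)) * Complex.I_sq
  have h4 : b + 2 * γ * a - β * d = 0 := by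
    linear_combination h1 - h3
  linear_combination (-β : ℂ) * h3 - 2 * γ * h4 - a * h'

/-- In real coordinates the exponent is -(β - 2γ)x² - (β + 2γ)y². No sign condition is needed: for a
nonpositive rate both the Gaussian integral and the square root are zero by convention. -/
theorem integral_planeGauss_one (γ β : ℝ) :
    ∫ z, planeGauss γ β 1 1 z
      = ((√(Real.pi / (β - 2 * γ)) * √(Real.pi / (β + 2 * γ)) : ℝ) : ℂ) := by
  rw [← (Complex.volume_preserving_equiv_real_prod.symm).integral_comp
    Complex.measurableEquivRealProd.symm.measurableEmbedding]
  rw [← integral_gaussian, ← integral_gaussian, ← integral_prod_mul (μ := volume) (ν := volume),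
    ← integral_complex_ofReal]
  refine integral_congr_ae (ae_of_all _ fun x => ?_)
  simp only [planeGauss, map_one, one_mul]
  rw [← Real.exp_add, Complex.ofReal_exp]
  congr 1
  apply Complex.ext <;> simp [Complex.measurableEquivRealProd, sq] <;> ring

theorem integral_planeGauss_hermiteH {γ β : ℝ} (hγ : 0 < γ) (hβ : 2 * γ < β)
    (h : β ^ 2 - 4 * γ ^ 2 = 4 * γ) (m n : ℕ) :
    ∫ z, planeGauss γ β (hermiteH m) (hermiteH n) z
      = if m = n then (n.factorial * (β / γ) ^ n *
        (√(Real.pi / (β - 2 * γ)) * √(Real.pi / (β + 2 * γ))) : ℝ) else 0 := by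
  have hγ' : (γ : ℂ) ≠ 0 := by exact_mod_cast hγ.ne'
  -- The weight is invariant under conjugation. This covers the case n = 0 < m, where the polynomial
  -- of positive degree stands in the variable z.
  have swap : ∀ p q, ∫ z, planeGauss γ β p q z = ∫ z, planeGauss γ β q p z := by
    intro p q
    have hmp : MeasurePreserving (Complex.conjLIE : ℂ ≃ₗᵢ[ℝ] ℂ) volume volume :=
      Complex.conjLIE.measurePreserving
    rw [← hmp.integral_comp Complex.conjLIE.toHomeomorph.measurableEmbedding]
    refine integral_congr_ae (ae_of_all _ fun z => ?_)
    simp only [planeGauss, Complex.conjLIE_apply, Complex.conj_conj]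
    rw [mul_comm (Polynomial.aeval _ p)]
    congr 2
    ring
  induction n generalizing m with
  | zero =>
    cases m with
    | zero => simp [hermiteH, integral_planeGauss_one γ β]
    | succ m =>
      rw [swap]
      have := integral_planeGauss_hermiteH_succ hγ hβ h (hermiteH 0) m
      have e : ∀ z, planeGauss γ β (Polynomial.derivative (hermiteH 0)) (hermiteH m) z = 0 := by
        intro z; simp [planeGauss, hermiteH]
      simp only [e, integral_zero, mul_zero, mul_eq_zero, hγ', OfNat.ofNat_ne_zero, false_or] at this
      simp [this]
  | succ n ih =>
    have := integral_planeGauss_hermiteH_succ hγ hβ h (hermiteH m) n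
    cases m with
    | zero =>
      have e : ∀ z, planeGauss γ β (Polynomial.derivative (hermiteH 0)) (hermiteH n) z = 0 := by
        intro z; simp [planeGauss, hermiteH]
      simp only [e, integral_zero, mul_zero, mul_eq_zero, hγ', OfNat.ofNat_ne_zero, false_or] at this
      simp [this]
    | succ m =>
      have e : ∀ z, planeGauss γ β (Polynomial.derivative (hermiteH (m + 1))) (hermiteH n) z
          = 2 * (m + 1) * planeGauss γ β (hermiteH m) (hermiteH n) z := by
        intro z
        simp only [planeGauss, derivative_hermiteH_succ, map_mul, map_add, map_ofNat, map_natCast,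
          map_one]
        ring
      simp only [e] at this
      rw [integral_const_mul, ih] at this
      by_cases hmn : m = n
      · subst hmn
        rw [if_pos rfl] at this ⊢
        refine mul_left_cancel₀ (mul_ne_zero two_ne_zero hγ') (this.trans ?_)
        rw [Nat.factorial_succ, pow_succ]
        push_cast
        field_simp
      · simp only [hmn, if_false, Complex.ofReal_zero, mul_zero, mul_eq_zero, hγ',
          OfNat.ofNat_ne_zero, false_or] at this
        simp [this, hmn]

/-! ### The Fock space -/

/-- The rate `2ε/(1-ε²)` of the Gaussian weight of the Fock space. -/
def fockRate (ε : ℝ) : ℝ := 2 * ε / (1 - ε ^ 2)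

theorem one_sub_sq_pos {ε : ℝ} (h0 : 0 < ε) (h1 : ε < 1) : 0 < 1 - ε ^ 2 := by nlinarith

theorem fockRate_pos {ε : ℝ} (h0 : 0 < ε) (h1 : ε < 1) : 0 < fockRate ε :=
  div_pos (by positivity) (one_sub_sq_pos h0 h1)

theorem fockMeasure_eq (ε : ℝ) : fockMeasure ε = (volume : Measure ℂ).withDensity
    fun z => ENNReal.ofReal (Real.exp (-(fockRate ε * ‖z‖ ^ 2))) := by
  rw [fockMeasure]
  congr 1
  funext z
  rw [fockRate]
  congr 3
  ring

theorem integral_fockMeasure (ε : ℝ) (f : ℂ → ℂ) :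
    ∫ z, f z ∂(fockMeasure ε) = ∫ z, f z * (Real.exp (-(fockRate ε * ‖z‖ ^ 2)) : ℂ) := by
  rw [fockMeasure_eq, integral_withDensity_eq_integral_toReal_smul (by fun_prop) (by simp)]
  refine integral_congr_ae (ae_of_all _ fun z => ?_)
  simp only [ENNReal.toReal_ofReal (Real.exp_pos _).le, Complex.real_smul]
  rw [mul_comm]

theorem integrable_fockMeasure (ε : ℝ) (f : ℂ → ℂ) :
    Integrable f (fockMeasure ε) ↔
      Integrable fun z => f z * (Real.exp (-(fockRate ε * ‖z‖ ^ 2)) : ℂ) := by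
  rw [fockMeasure_eq, integrable_withDensity_iff_integrable_smul' (by fun_prop) (by simp)]
  refine integrable_congr (ae_of_all _ fun z => ?_)
  simp only [ENNReal.toReal_ofReal (Real.exp_pos _).le, Complex.real_smul]
  rw [mul_comm]

theorem memLp_fockMeasure_iff (ε : ℝ) {f : ℂ → ℂ} (hf : Continuous f) :
    MemLp f 2 (fockMeasure ε) ↔
      Integrable fun z => ‖f z‖ ^ 2 * Real.exp (-(fockRate ε * ‖z‖ ^ 2)) := by
  rw [memLp_two_iff_integrable_sq_norm hf.aestronglyMeasurable, fockMeasure_eq,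
    integrable_withDensity_iff_integrable_smul' (by fun_prop) (by simp)]
  refine integrable_congr (ae_of_all _ fun z => ?_)
  simp only [ENNReal.toReal_ofReal (Real.exp_pos _).le, smul_eq_mul]
  rw [mul_comm]

theorem coeFn_fockE {ε : ℝ} (h0 : 0 < ε) (h1 : ε < 1) (n : ℕ) :
    ((fockE h0 h1 n : fockSpace ε) : Lp ℂ 2 (fockMeasure ε)) =ᵐ[fockMeasure ε] fockFun ε n :=
  (memLp_fockFun h0 h1 n).coeFn_toLp

/-- The constant factor of `fockFun`. -/
def fockCoeff (ε : ℝ) (n : ℕ) : ℝ :=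
  (√(ε ^ n) / √(n.factorial * 2 ^ n * √Real.pi))
      * (√(2 * ε) / ((1 - ε ^ 2) * Real.pi) ^ (1 / 4 : ℝ))

/-- The factors e^{γz²} of the E_n, γ = ε²/(1-ε²), combine with the Fock weight to the plane weight
above, and γ, β = 2ε/(1-ε²) satisfy β² - 4γ² = 4γ. The ratio β/γ = 2/ε explains the factor ε^{n/2}
in the normalization of E_n. -/
theorem orthonormal_fockE {ε : ℝ} (h0 : 0 < ε) (h1 : ε < 1) :
    Orthonormal ℂ (fockE h0 h1) := by
  rw [orthonormal_iff_ite]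
  intro m n
  have hs := one_sub_sq_pos h0 h1
  rw [Submodule.coe_inner, L2.inner_def]
  have e : ∀ᵐ z ∂(fockMeasure ε), inner ℂ ((fockE h0 h1 m : Lp ℂ 2 (fockMeasure ε)) z)
      ((fockE h0 h1 n : Lp ℂ 2 (fockMeasure ε)) z)
      = fockFun ε n z * (starRingEnd ℂ) (fockFun ε m z) := by
    filter_upwards [coeFn_fockE h0 h1 m, coeFn_fockE h0 h1 n] with z e1 e2
    rw [e1, e2, RCLike.inner_apply]
  set γ : ℝ := ε ^ 2 / (1 - ε ^ 2) with hγ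
  have e' : ∀ z : ℂ, fockFun ε n z * (starRingEnd ℂ) (fockFun ε m z)
      * (Real.exp (-(fockRate ε * ‖z‖ ^ 2)) : ℂ)
      = ((fockCoeff ε n * fockCoeff ε m : ℝ) : ℂ) *
        planeGauss γ (fockRate ε) (hermiteH n) (hermiteH m) z := by
    intro z
    have : (γ * z ^ 2 + γ * (starRingEnd ℂ) z ^ 2 - fockRate ε * z * (starRingEnd ℂ) z : ℂ)
        = γ * z ^ 2 + γ * (starRingEnd ℂ) z ^ 2 + ((-(fockRate ε * ‖z‖ ^ 2) : ℝ) : ℂ) := by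
      rw [mul_assoc, Complex.mul_conj, Complex.normSq_eq_norm_sq]
      push_cast
      ring
    rw [fockFun, fockFun, planeGauss, map_mul, map_mul, conj_aeval, ← Complex.exp_conj,
      Complex.conj_ofReal, map_mul, Complex.conj_ofReal, map_pow, this, Complex.exp_add,
      Complex.exp_add, Complex.ofReal_exp]
    simp only [fockCoeff, ← hγ]
    push_cast
    ring
  rw [integral_congr_ae e, integral_fockMeasure]
  simp only [e']
  have hb2 : fockRate ε - 2 * γ = 2 * ε / (1 + ε) := by
    rw [fockRate, hγ]
    have : 1 - ε ≠ 0 := by linarith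
    have : 1 - ε ^ 2 = (1 - ε) * (1 + ε) := by ring
    rw [this]
    field_simp
  have hb3 : fockRate ε + 2 * γ = 2 * ε / (1 - ε) := by
    rw [fockRate, hγ]
    have : 1 - ε ≠ 0 := by linarith
    have : 1 - ε ^ 2 = (1 - ε) * (1 + ε) := by ring
    rw [this]
    field_simp
  have hpos : 0 < 2 * ε / (1 + ε) := by positivity
  rw [integral_const_mul, integral_planeGauss_hermiteH (γ := γ) (by positivity) (by linarith)
    (by rw [fockRate, hγ]; field_simp; ring)]
  by_cases h : m = n
  · subst h
    rw [if_pos rfl, if_pos rfl, ← Complex.ofReal_mul, ← Complex.ofReal_one]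
    congr 1
    have r1 : fockRate ε / γ = 2 / ε := by rw [fockRate, hγ]; field_simp
    have r2 : √(Real.pi / (fockRate ε - 2 * γ)) * √(Real.pi / (fockRate ε + 2 * γ))
        = Real.pi * √(1 - ε ^ 2) / (2 * ε) := by
      have h1' : 0 < 1 - ε := by linarith
      rw [hb2, hb3, ← Real.sqrt_mul (by positivity)]
      rw [Real.sqrt_eq_iff_mul_self_eq (by positivity) (by positivity)]
      have := Real.mul_self_sqrt hs.le
      field_simp
      rw [sq (√_), this]
      ring
    have r3 : fockCoeff ε m * fockCoeff ε m
        = ε ^ m / (m.factorial * 2 ^ m * √Real.pi) * (2 * ε / (√(1 - ε ^ 2) * √Real.pi)) := by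
      have q : (((1 - ε ^ 2) * Real.pi) ^ (1 / 4 : ℝ)) * (((1 - ε ^ 2) * Real.pi) ^ (1 / 4 : ℝ))
          = √(1 - ε ^ 2) * √Real.pi := by
        rw [← Real.rpow_add (by positivity), ← Real.sqrt_mul hs.le, Real.sqrt_eq_rpow]
        norm_num
      rw [fockCoeff, mul_mul_mul_comm, div_mul_div_comm, div_mul_div_comm,
        Real.mul_self_sqrt (by positivity), Real.mul_self_sqrt (by positivity),
        Real.mul_self_sqrt (by positivity), q]
    have hpi := Real.mul_self_sqrt Real.pi_pos.le
    have : √(1 - ε ^ 2) ≠ 0 := by positivity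
    rw [r1, r2, r3, div_pow]
    field_simp
    rw [sq, hpi]
  · simp [h, Ne.symm h]

/-! ### The reproducing kernel -/

/-- Mean value property of entire functions for rotation invariant Gaussian weights. -/
theorem integral_mul_exp_neg_mul_sq {G : ℂ → ℂ} (hG : Differentiable ℂ G) {b : ℝ} (hb : 0 < b)
    (hi : Integrable fun z => G z * (Real.exp (-(b * ‖z‖ ^ 2)) : ℂ)) :
    ∫ z, G z * (Real.exp (-(b * ‖z‖ ^ 2)) : ℂ) = G 0 * (Real.pi / b : ℝ) := by
  have hc : Continuous G := hG.continuous
  -- ν parametrizes the rotations. Rotating the variable does not change the integral, while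
  -- averaging G(e^{iθ}z) over θ gives G(0).
  set ν : Measure ℝ := volume.restrict (Set.Ioc 0 (2 * Real.pi)) with hν
  have hrot : ∀ θ : ℝ, MeasurePreserving (fun z : ℂ => Circle.exp θ * z) volume volume :=
    fun θ => (rotation (Circle.exp θ)).measurePreserving
  have hemb : ∀ θ : ℝ, MeasurableEmbedding (fun z : ℂ => Circle.exp θ * z) :=
    fun θ => (rotation (Circle.exp θ)).toHomeomorph.measurableEmbedding
  have hnorm : ∀ (θ : ℝ) (z : ℂ), ‖(Circle.exp θ : ℂ) * z‖ = ‖z‖ := fun θ z => by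
    simp
  have hiθ : ∀ θ : ℝ, Integrable fun z : ℂ =>
      G (Circle.exp θ * z) * (Real.exp (-(b * ‖z‖ ^ 2)) : ℂ) := by
    intro θ
    have := ((hrot θ).integrable_comp_emb (hemb θ)).2 hi
    simpa only [Function.comp_def, hnorm] using this
  have hconst : ∀ θ : ℝ, ∫ z : ℂ, G (Circle.exp θ * z) * (Real.exp (-(b * ‖z‖ ^ 2)) : ℂ)
      = ∫ z, G z * (Real.exp (-(b * ‖z‖ ^ 2)) : ℂ) := by
    intro θ
    have := (hrot θ).integral_comp (hemb θ) fun z => G z * (Real.exp (-(b * ‖z‖ ^ 2)) : ℂ)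
    simpa only [hnorm] using this
  have hconstn : ∀ θ : ℝ, ∫ z : ℂ, ‖G (Circle.exp θ * z) * (Real.exp (-(b * ‖z‖ ^ 2)) : ℂ)‖
      = ∫ z, ‖G z * (Real.exp (-(b * ‖z‖ ^ 2)) : ℂ)‖ := by
    intro θ
    have := (hrot θ).integral_comp (hemb θ) fun z =>
      ‖G z * (Real.exp (-(b * ‖z‖ ^ 2)) : ℂ)‖
    simpa only [hnorm] using this
  have hfin : IsFiniteMeasure ν := by rw [hν]; infer_instance
  have hprod : Integrable (Function.uncurry fun (θ : ℝ) (z : ℂ) =>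
      G (Circle.exp θ * z) * (Real.exp (-(b * ‖z‖ ^ 2)) : ℂ)) (ν.prod volume) := by
    rw [integrable_prod_iff]
    · refine ⟨ae_of_all _ fun θ => hiθ θ, ?_⟩
      simp only [Function.uncurry, hconstn]
      exact integrable_const _
    · refine Continuous.aestronglyMeasurable ?_
      unfold Function.uncurry
      have : Continuous fun p : ℝ × ℂ => (Circle.exp p.1 : ℂ) :=
        continuous_subtype_val.comp (Circle.exp.continuous.comp continuous_fst)
      fun_prop
  have havg : ∀ z : ℂ, ∫ θ, G (Circle.exp θ * z) * (Real.exp (-(b * ‖z‖ ^ 2)) : ℂ) ∂ν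
      = 2 * Real.pi * (G 0 * (Real.exp (-(b * ‖z‖ ^ 2)) : ℂ)) := by
    intro z
    have hd : Differentiable ℂ fun w => G (w * z) := by fun_prop
    have hm : Real.circleAverage (fun w => G (w * z)) 0 1 = G (0 * z) :=
      DiffContOnCl.circleAverage hd.diffContOnCl
    rw [Real.circleAverage_def, intervalIntegral.integral_of_le (by positivity),
      zero_mul] at hm
    rw [integral_mul_const, hν, ← hm]
    simp only [circleMap, Complex.ofReal_one, one_mul, zero_add, Circle.coe_exp,
      Complex.real_smul]
    rw [← mul_assoc, ← mul_assoc]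
    congr 1
    push_cast
    rw [mul_inv_cancel₀, one_mul]
    exact_mod_cast (by positivity : (2 * Real.pi : ℝ) ≠ 0)
  have hswap := integral_integral_swap hprod
  simp only [hconst, havg] at hswap
  rw [integral_const, integral_const_mul, integral_const_mul] at hswap
  have hνu : ν.real Set.univ = 2 * Real.pi := by
    simp [hν, Measure.real, Real.pi_pos.le]
  rw [hνu, Complex.real_smul] at hswap
  push_cast at hswap
  have h2 : (2 * Real.pi : ℂ) ≠ 0 := by exact_mod_cast (by positivity : (2 * Real.pi : ℝ) ≠ 0)
  have h3 := mul_left_cancel₀ h2 hswap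
  push_cast
  rw [h3]
  congr 1
  have h4 := GaussianFourier.integral_rexp_neg_mul_sq_norm (V := ℂ) hb
  rw [Complex.finrank_real_complex] at h4
  norm_num at h4
  have h5 := congrArg (fun x : ℝ => (x : ℂ)) h4
  simp only [← integral_complex_ofReal] at h5
  simpa using h5

instance instInnerFockSpace (ε : ℝ) : Inner ℂ (fockSpace ε) := InnerProductSpace.toInner

/-- The reproducing kernel `(β/π) e^{β z w̄}`, `β = 2ε/(1-ε²)`, of the Fock space. -/
def reproFun (ε : ℝ) (w z : ℂ) : ℂ :=
  (fockRate ε / Real.pi : ℝ) * Complex.exp (fockRate ε * z * (starRingEnd ℂ) w)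

theorem differentiable_reproFun (ε : ℝ) (w : ℂ) : Differentiable ℂ (reproFun ε w) := by
  unfold reproFun
  fun_prop

theorem memLp_reproFun {ε : ℝ} (h0 : 0 < ε) (h1 : ε < 1) (w : ℂ) :
    MemLp (reproFun ε w) 2 (fockMeasure ε) := by
  have hβ := fockRate_pos h0 h1
  rw [memLp_fockMeasure_iff ε (differentiable_reproFun ε w).continuous]
  have hc := (differentiable_reproFun ε w).continuous
  refine ((integrable_exp_neg_mul_sq_norm (b := fockRate ε / 2) (by positivity)).const_mul
    ((fockRate ε / Real.pi) ^ 2 * Real.exp (2 * fockRate ε * ‖w‖ ^ 2))).mono'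
    (by fun_prop) (ae_of_all _ fun z => ?_)
  rw [Real.norm_of_nonneg (by positivity), reproFun, norm_mul, Complex.norm_real,
    Real.norm_of_nonneg (by positivity), Complex.norm_exp, mul_pow, ← Real.exp_nat_mul,
    mul_assoc (_ ^ 2), mul_assoc (_ ^ 2), ← Real.exp_add, ← Real.exp_add]
  refine mul_le_mul_of_nonneg_left (Real.exp_le_exp.2 ?_) (by positivity)
  have h2 : (fockRate ε * z * (starRingEnd ℂ) w).re ≤ fockRate ε * (‖z‖ * ‖w‖) := by
    refine (Complex.re_le_norm _).trans (le_of_eq ?_)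
    rw [norm_mul, norm_mul, RCLike.norm_conj, Complex.norm_real, Real.norm_of_nonneg hβ.le,
      mul_assoc]
  push_cast
  -- Here 2‖z‖‖w‖ ≤ ‖z‖²/2 + 2‖w‖², so the kernel uses only half of the Gaussian weight.
  nlinarith [mul_nonneg hβ.le (sq_nonneg (‖z‖ - 2 * ‖w‖))]

/-- The reproducing kernel as an element of the Fock space. -/
def reproK {ε : ℝ} (h0 : 0 < ε) (h1 : ε < 1) (w : ℂ) : fockSpace ε :=
  ⟨(memLp_reproFun h0 h1 w).toLp, reproFun ε w, differentiable_reproFun ε w, MemLp.coeFn_toLp _⟩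

theorem coeFn_reproK {ε : ℝ} (h0 : 0 < ε) (h1 : ε < 1) (w : ℂ) :
    ((reproK h0 h1 w : fockSpace ε) : Lp ℂ 2 (fockMeasure ε)) =ᵐ[fockMeasure ε] reproFun ε w :=
  (memLp_reproFun h0 h1 w).coeFn_toLp

/-- After the translation z = u + w, the conjugate kernel times the weight becomes e^{-βuw̄}
e^{-β|u|²} up to the constant β/π. The first factor is entire in u, so the mean value property
evaluates the integral at u = 0. Any entire representative G may be used, which turns almost
everywhere statements into pointwise ones. -/
theorem inner_reproK {ε : ℝ} (h0 : 0 < ε) (h1 : ε < 1) (w : ℂ) (g : fockSpace ε) {G : ℂ → ℂ}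
    (hG : Differentiable ℂ G) (hg : (g : Lp ℂ 2 (fockMeasure ε)) =ᵐ[fockMeasure ε] G) :
    inner ℂ (reproK h0 h1 w) g = G w := by
  have hβ := fockRate_pos h0 h1
  have e : (fun z => inner ℂ ((reproK h0 h1 w : Lp ℂ 2 (fockMeasure ε)) z)
      ((g : Lp ℂ 2 (fockMeasure ε)) z))
      =ᵐ[fockMeasure ε] fun z => G z * (starRingEnd ℂ) (reproFun ε w z) := by
    filter_upwards [coeFn_reproK h0 h1 w, hg] with z e1 e2
    rw [e1, e2, RCLike.inner_apply]
  have hi := (L2.integrable_inner (𝕜 := ℂ) (reproK h0 h1 w : Lp ℂ 2 (fockMeasure ε))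
    (g : Lp ℂ 2 (fockMeasure ε))).congr e
  rw [integrable_fockMeasure] at hi
  rw [Submodule.coe_inner, L2.inner_def, integral_congr_ae e, integral_fockMeasure]
  have e' : ∀ u : ℂ, G (u + w) * (starRingEnd ℂ) (reproFun ε w (u + w))
      * (Real.exp (-(fockRate ε * ‖u + w‖ ^ 2)) : ℂ)
      = (fockRate ε / Real.pi : ℝ) * (G (u + w) * Complex.exp (-(fockRate ε * u * (starRingEnd ℂ) w))
        * (Real.exp (-(fockRate ε * ‖u‖ ^ 2)) : ℂ)) := by
    intro u
    have hn : ∀ v : ℂ, ((-(fockRate ε * ‖v‖ ^ 2) : ℝ) : ℂ)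
        = -(fockRate ε * v * (starRingEnd ℂ) v) := by
      intro v
      rw [mul_assoc, Complex.mul_conj, Complex.normSq_eq_norm_sq]
      push_cast
      ring
    have he : Complex.exp ((starRingEnd ℂ) (fockRate ε * (u + w) * (starRingEnd ℂ) w))
        * Complex.exp (-(fockRate ε * (u + w) * (starRingEnd ℂ) (u + w)))
        = Complex.exp (-(fockRate ε * u * (starRingEnd ℂ) w))
        * Complex.exp (-(fockRate ε * u * (starRingEnd ℂ) u)) := by
      rw [← Complex.exp_add, ← Complex.exp_add]
      congr 1
      simp only [map_mul, map_add, Complex.conj_ofReal, Complex.conj_conj]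
      ring
    rw [reproFun, map_mul, Complex.conj_ofReal, ← Complex.exp_conj, Complex.ofReal_exp,
      Complex.ofReal_exp, hn, hn]
    linear_combination ((fockRate ε / Real.pi : ℝ) : ℂ) * G (u + w) * he
  have hi' := (hi.comp_add_right w)
  simp only [e'] at hi'
  have hr : ((fockRate ε / Real.pi : ℝ) : ℂ) ≠ 0 := by
    exact_mod_cast (by positivity : fockRate ε / Real.pi ≠ 0)
  have hi2 : Integrable fun u : ℂ => G (u + w)
      * Complex.exp (-(fockRate ε * u * (starRingEnd ℂ) w))
        * (Real.exp (-(fockRate ε * ‖u‖ ^ 2)) : ℂ) := by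
    refine (hi'.const_mul ((fockRate ε / Real.pi : ℝ) : ℂ)⁻¹).congr (ae_of_all _ fun u => ?_)
    simp only
    rw [← mul_assoc, inv_mul_cancel₀ hr, one_mul]
  rw [← integral_add_right_eq_self _ w]
  simp only [e']
  rw [integral_const_mul, integral_mul_exp_neg_mul_sq (by fun_prop) hβ hi2]
  simp only [zero_add, mul_zero, zero_mul, neg_zero, Complex.exp_zero, mul_one]
  rw [mul_left_comm, ← Complex.ofReal_mul]
  have : fockRate ε / Real.pi * (Real.pi / fockRate ε) = 1 := by field_simp
  rw [this]
  simp

/-! ### The integral kernel of the unitary map -/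

/-- The constant factor of the integral kernel. -/
def kernelCoeff (ε : ℝ) : ℝ :=
  √(2 * ε) / ((1 - ε ^ 2) * Real.pi) ^ (1 / 4 : ℝ) / √(Real.pi * (1 - ε))

/-- The integral kernel of the unitary map from `L²(ℝ)` onto the Fock space. -/
def fockKernel (ε : ℝ) (z : ℂ) (x : ℝ) : ℂ :=
  kernelCoeff ε * Complex.exp (-(fockRate ε / 2) * z ^ 2) *
    Complex.exp ((-((1 + ε) / (1 - ε) / 2 : ℝ) : ℂ) * x ^ 2
      + ((2 * √ε / (1 - ε) : ℝ) : ℂ) * z * x)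

theorem conj_fockKernel (ε : ℝ) (z : ℂ) (x : ℝ) :
    (starRingEnd ℂ) (fockKernel ε z x) = fockKernel ε ((starRingEnd ℂ) z) x := by
  simp only [fockKernel, map_mul, Complex.conj_ofReal, ← Complex.exp_conj, map_add, map_neg,
    map_pow, map_div₀, map_ofNat]

theorem kernel_rate_neg {ε : ℝ} (h0 : 0 < ε) (h1 : ε < 1) :
    (-((1 + ε) / (1 - ε) / 2 : ℝ) : ℂ).re < 0 := by
  have : 0 < 1 - ε := by linarith
  rw [← Complex.ofReal_neg, Complex.ofReal_re]
  simp only [Left.neg_neg_iff]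
  positivity

theorem memLp_fockKernel {ε : ℝ} (h0 : 0 < ε) (h1 : ε < 1) (z : ℂ) :
    MemLp (fockKernel ε z) 2 volume := by
  have := (memLp_aeval_mul_cexp 1 (kernel_rate_neg h0 h1)
    (((2 * √ε / (1 - ε) : ℝ) : ℂ) * z)).const_mul
    (kernelCoeff ε * Complex.exp (-(fockRate ε / 2) * z ^ 2))
  refine this.ae_eq (ae_of_all _ fun x => ?_)
  simp [fockKernel]

/-- The coherent state `x ↦ conj k(z,x)`, `k` the integral kernel. -/
def coherent {ε : ℝ} (h0 : 0 < ε) (h1 : ε < 1) (z : ℂ) : Lp ℂ 2 (volume : Measure ℝ) :=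
  (memLp_fockKernel h0 h1 ((starRingEnd ℂ) z)).toLp

theorem inner_coherent {ε : ℝ} (h0 : 0 < ε) (h1 : ε < 1) (z : ℂ)
    {f : Lp ℂ 2 (volume : Measure ℝ)} {F : ℝ → ℂ} (hf : f =ᵐ[volume] F) :
    inner ℂ (coherent h0 h1 z) f = ∫ x, fockKernel ε z x * F x := by
  rw [L2.inner_def]
  refine integral_congr_ae ?_
  filter_upwards [(memLp_fockKernel h0 h1 ((starRingEnd ℂ) z)).coeFn_toLp, hf] with x e1 e2
  rw [coherent, e1, e2, RCLike.inner_apply, conj_fockKernel, Complex.conj_conj, mul_comm]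

/-- The rate 1/(1-ε) is the sum of the rate (1+ε)/(2(1-ε)) of the kernel and the rate 1/2 of h_n.
With it, the recurrence for these integrals J_n reads J_{n+2} = 2√ε z J_{n+1} - 2(n+1)ε J_n, which
is the recurrence of (√ε)^n H_n(z). -/
theorem integral_hermiteH_mul_cexp {ε : ℝ} (h0 : 0 < ε) (h1 : ε < 1) (z : ℂ) (n : ℕ) :
    ∫ x : ℝ, Polynomial.aeval (x : ℂ) (hermiteH n) *
        Complex.exp ((-(1 / (1 - ε) : ℝ) : ℂ) * x ^ 2 + ((2 * √ε / (1 - ε) : ℝ) : ℂ) * z * x)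
      = ((√ε : ℝ) : ℂ) ^ n * Polynomial.aeval z (hermiteH n) *
        ((√(Real.pi * (1 - ε)) : ℝ) * Complex.exp ((ε / (1 - ε) : ℝ) * z ^ 2)) := by
  have h1' : 0 < 1 - ε := by linarith
  have hne : (1 - ε : ℂ) ≠ 0 := by exact_mod_cast h1'.ne'
  have hb : (-(1 / (1 - ε) : ℝ) : ℂ).re < 0 := by
    rw [← Complex.ofReal_neg, Complex.ofReal_re]
    simp only [Left.neg_neg_iff]
    positivity
  have hs : ((√ε : ℝ) : ℂ) ^ 2 = ε := by
    rw [← Complex.ofReal_pow, Real.sq_sqrt h0.le]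
  have hz : ∫ x : ℝ, Polynomial.aeval (x : ℂ) (hermiteH 0) *
        Complex.exp ((-(1 / (1 - ε) : ℝ) : ℂ) * x ^ 2 + ((2 * √ε / (1 - ε) : ℝ) : ℂ) * z * x)
      = (√(Real.pi * (1 - ε)) : ℝ) * Complex.exp ((ε / (1 - ε) : ℝ) * z ^ 2) := by
    have := integral_cexp_quadratic hb (((2 * √ε / (1 - ε) : ℝ) : ℂ) * z) 0
    simp only [add_zero] at this
    simp only [hermiteH, map_one, one_mul, this]
    congr 1
    · rw [neg_neg, Real.sqrt_eq_rpow, Complex.ofReal_cpow (by positivity)]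
      push_cast
      congr 1
      field_simp
    · congr 1
      push_cast
      field_simp
      linear_combination (4 * z ^ 2) * hs
  have rec1 := integral_hermiteH_one_mul_cexp hb (((2 * √ε / (1 - ε) : ℝ) : ℂ) * z)
  have rec2 := integral_hermiteH_mul_cexp_rec hb (((2 * √ε / (1 - ε) : ℝ) : ℂ) * z)
  obtain ⟨J, hJ⟩ : ∃ J : ℕ → ℂ, ∀ n, (∫ x : ℝ, Polynomial.aeval (x : ℂ) (hermiteH n) *
        Complex.exp ((-(1 / (1 - ε) : ℝ) : ℂ) * x ^ 2 + ((2 * √ε / (1 - ε) : ℝ) : ℂ) * z * x))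
      = J n := ⟨_, fun _ => rfl⟩
  simp only [hJ] at hz rec1 rec2 ⊢
  generalize ((√(Real.pi * (1 - ε)) : ℝ) * Complex.exp ((ε / (1 - ε) : ℝ) * z ^ 2) : ℂ) = M at *
  induction n using Nat.twoStepInduction with
  | zero => rw [hz]; simp [hermiteH]
  | one =>
    rw [hz] at rec1
    push_cast at rec1
    field_simp at rec1
    rw [rec1]
    simp only [hermiteH, mul_one, Polynomial.derivative_one, sub_zero, map_mul, map_ofNat,
      Polynomial.aeval_X]
    ring
  | more n ih1 ih2 =>
    have h := rec2 n
    rw [ih1, ih2] at h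
    rw [hermiteH_succ_succ]
    simp only [map_sub, map_mul, map_add, map_ofNat, map_natCast, map_one, Polynomial.aeval_X]
    push_cast at h
    field_simp at h
    rw [h, pow_add _ n 2, pow_add _ n 1, hs]
    linear_combination (2 * ((√ε : ℝ) : ℂ) ^ n * z * Polynomial.aeval z (hermiteH (n + 1)) * M) * hs

theorem inner_coherent_hermiteL2 {ε : ℝ} (h0 : 0 < ε) (h1 : ε < 1) (z : ℂ) (n : ℕ) :
    inner ℂ (coherent h0 h1 z) (hermiteL2 n) = fockFun ε n z := by
  have h1' : 0 < 1 - ε := by linarith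
  have h1'' := one_sub_sq_pos h0 h1
  have hne : (1 - ε : ℂ) ≠ 0 := by exact_mod_cast h1'.ne'
  rw [inner_coherent h0 h1 z (f := hermiteL2 n) (memLp_hermiteFun n).coeFn_toLp]
  have e : ∀ x : ℝ, fockKernel ε z x * hermiteFun n x
      = (kernelCoeff ε * Complex.exp (-(fockRate ε / 2) * z ^ 2)
        * ((√(n.factorial * 2 ^ n * √Real.pi))⁻¹ : ℝ)) * (Polynomial.aeval (x : ℂ) (hermiteH n) *
        Complex.exp ((-(1 / (1 - ε) : ℝ) : ℂ) * x ^ 2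
          + ((2 * √ε / (1 - ε) : ℝ) : ℂ) * z * x)) := by
    intro x
    have : (-(1 / (1 - ε) : ℝ) : ℂ) * x ^ 2 + ((2 * √ε / (1 - ε) : ℝ) : ℂ) * z * x
        = ((-((1 + ε) / (1 - ε) / 2 : ℝ) : ℂ) * x ^ 2 + ((2 * √ε / (1 - ε) : ℝ) : ℂ) * z * x)
          + (-(1 / 2) * x ^ 2 + 0 * x) := by
      push_cast
      field_simp
      ring
    rw [this, Complex.exp_add (_ + _) (_ + _), fockKernel, hermiteFun_eq]
    ring
  simp only [e]
  rw [integral_const_mul, integral_hermiteH_mul_cexp h0 h1, fockFun]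
  have e2 : Complex.exp (-(fockRate ε / 2) * z ^ 2) * Complex.exp ((ε / (1 - ε) : ℝ) * z ^ 2)
      = Complex.exp ((ε ^ 2 / (1 - ε ^ 2) : ℝ) * z ^ 2) := by
    rw [← Complex.exp_add, fockRate]
    congr 1
    have : (1 - ε ^ 2 : ℂ) = (1 - ε) * (1 + ε) := by ring
    have hp : (1 + ε : ℂ) ≠ 0 := by exact_mod_cast (by positivity : 1 + ε ≠ 0)
    push_cast
    rw [this]
    field_simp
    ring
  rw [← e2]
  have e3 : √(ε ^ n) / √(n.factorial * 2 ^ n * √Real.pi)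
      * (√(2 * ε) / ((1 - ε ^ 2) * Real.pi) ^ (1 / 4 : ℝ))
      = kernelCoeff ε * (√(n.factorial * 2 ^ n * √Real.pi))⁻¹ * √ε ^ n * √(Real.pi * (1 - ε)) := by
    have hsq : √(ε ^ n) = √ε ^ n := by
      rw [Real.sqrt_eq_iff_mul_self_eq (by positivity) (by positivity), ← mul_pow,
        Real.mul_self_sqrt h0.le]
    rw [kernelCoeff, hsq]
    have : √(Real.pi * (1 - ε)) ≠ 0 := by positivity
    field_simp
  rw [e3]
  push_cast
  ring

/-- This normalization is what makes the inner products of the coherent states equal to the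
reproducing kernel, constant included. -/
theorem sq_kernelCoeff {ε : ℝ} (h0 : 0 < ε) (h1 : ε < 1) :
    kernelCoeff ε ^ 2 * √(Real.pi / ((1 + ε) / (1 - ε))) = fockRate ε / Real.pi := by
  have h1' : 0 < 1 - ε := by linarith
  have h1'' := one_sub_sq_pos h0 h1
  have q : (((1 - ε ^ 2) * Real.pi) ^ (1 / 4 : ℝ)) ^ 2 = √((1 - ε ^ 2) * Real.pi) := by
    rw [← Real.rpow_natCast, ← Real.rpow_mul (by positivity), Real.sqrt_eq_rpow]
    norm_num
  have q2 : √(Real.pi / ((1 + ε) / (1 - ε))) = √((1 - ε ^ 2) * Real.pi) / (1 + ε) := by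
    rw [Real.sqrt_eq_iff_mul_self_eq (by positivity) (by positivity), div_mul_div_comm,
      Real.mul_self_sqrt (by positivity)]
    field_simp
    ring
  rw [kernelCoeff, div_pow, div_pow, q, q2, Real.sq_sqrt (by positivity),
    Real.sq_sqrt (by positivity), fockRate]
  have : √((1 - ε ^ 2) * Real.pi) ≠ 0 := by positivity
  have e : 1 - ε ^ 2 = (1 - ε) * (1 + ε) := by ring
  field_simp
  rw [e]

/-- Completing the square in x yields (β/2)(z + w̄)² in the exponent. The prefactors of the two
kernels remove the pure squares, so only the cross term βzw̄ survives. -/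
theorem inner_coherent_coherent {ε : ℝ} (h0 : 0 < ε) (h1 : ε < 1) (z w : ℂ) :
    inner ℂ (coherent h0 h1 z) (coherent h0 h1 w) = reproFun ε w z := by
  have h1' : 0 < 1 - ε := by linarith
  have h1'' := one_sub_sq_pos h0 h1
  have hne : (1 - ε : ℂ) ≠ 0 := by exact_mod_cast h1'.ne'
  have hp : (1 + ε : ℂ) ≠ 0 := by exact_mod_cast (by positivity : 1 + ε ≠ 0)
  have hb : (-((1 + ε) / (1 - ε) : ℝ) : ℂ).re < 0 := by
    rw [← Complex.ofReal_neg, Complex.ofReal_re]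
    simp only [Left.neg_neg_iff]
    positivity
  have hs : ((√ε : ℝ) : ℂ) ^ 2 = ε := by
    rw [← Complex.ofReal_pow, Real.sq_sqrt h0.le]
  rw [inner_coherent h0 h1 z (f := coherent h0 h1 w)
    (memLp_fockKernel h0 h1 ((starRingEnd ℂ) w)).coeFn_toLp]
  set v := (starRingEnd ℂ) w with hv
  have e : ∀ x : ℝ, fockKernel ε z x * fockKernel ε v x = (kernelCoeff ε ^ 2 : ℝ) *
      Complex.exp ((-((1 + ε) / (1 - ε) : ℝ) : ℂ) * x ^ 2
        + ((2 * √ε / (1 - ε) : ℝ) : ℂ) * (z + v) * x + (-(fockRate ε / 2) * (z ^ 2 + v ^ 2))) := by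
    intro x
    have : (-((1 + ε) / (1 - ε) : ℝ) : ℂ) * x ^ 2
        + ((2 * √ε / (1 - ε) : ℝ) : ℂ) * (z + v) * x + (-(fockRate ε / 2) * (z ^ 2 + v ^ 2))
        = (-(fockRate ε / 2) * z ^ 2 + ((-((1 + ε) / (1 - ε) / 2 : ℝ) : ℂ) * x ^ 2
          + ((2 * √ε / (1 - ε) : ℝ) : ℂ) * z * x)) + (-(fockRate ε / 2) * v ^ 2 +
          ((-((1 + ε) / (1 - ε) / 2 : ℝ) : ℂ) * x ^ 2
          + ((2 * √ε / (1 - ε) : ℝ) : ℂ) * v * x)) := by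
      push_cast
      ring
    rw [this, Complex.exp_add (_ + (_ + _)) (_ + (_ + _)), Complex.exp_add _ (_ + _),
      Complex.exp_add _ (_ + _), fockKernel, fockKernel]
    push_cast
    ring
  simp only [e]
  rw [integral_const_mul, integral_cexp_quadratic hb, reproFun, ← mul_assoc, ← sq_kernelCoeff h0 h1,
    Complex.ofReal_mul]
  congr 2
  · rw [neg_neg, Real.sqrt_eq_rpow, Complex.ofReal_cpow (by positivity)]
    push_cast
    rfl
  · rw [fockRate, ← hv]
    have : (1 - ε ^ 2 : ℂ) = (1 - ε) * (1 + ε) := by ring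
    push_cast
    rw [this]
    field_simp
    linear_combination (4 * (z + v) ^ 2) * hs

/-! ### Completeness of the functions `E_n` -/

/-- Point evaluation is continuous on the Fock space, so g(z) = Σ ⟨h_n,f⟩ E_n(z). Since the E_n(z)
are the Hermite coefficients of the coherent state at z, Parseval's identity sums the series. -/
theorem inner_reproK_of_hasSum {ε : ℝ} (h0 : 0 < ε) (h1 : ε < 1)
    {f : Lp ℂ 2 (volume : Measure ℝ)} {g : fockSpace ε}
    (h : HasSum (fun n => inner ℂ (hermiteL2 n) f • fockE h0 h1 n) g) (z : ℂ) :
    inner ℂ (reproK h0 h1 z) g = inner ℂ (coherent h0 h1 z) f := by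
  have h2 := h.mapL (innerSL ℂ (reproK h0 h1 z))
  have h3 := hermiteBasis.hasSum_inner_mul_inner (coherent h0 h1 z) f
  have e : ∀ n, innerSL ℂ (reproK h0 h1 z) (inner ℂ (hermiteL2 n) f • fockE h0 h1 n)
      = inner ℂ (hermiteL2 n) f * fockFun ε n z := fun n =>
    (inner_smul_right (reproK h0 h1 z) (fockE h0 h1 n) _).trans (congrArg _
      (inner_reproK h0 h1 z _ (differentiable_fockFun ε n) (coeFn_fockE h0 h1 n)))
  simp only [e] at h2
  simp only [coe_hermiteBasis, inner_coherent_hermiteL2, mul_comm (fockFun ε _ _)] at h3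
  exact h2.unique h3

/-- The Hermite coefficients of a coherent state are square summable, so orthonormality of the E_n
alone makes the series converge. Its sum is recognized by its point values, which are inner products
of coherent states. -/
theorem hasSum_reproK {ε : ℝ} (h0 : 0 < ε) (h1 : ε < 1) (w : ℂ) :
    HasSum (fun n => inner ℂ (hermiteL2 n) (coherent h0 h1 w) • fockE h0 h1 n)
      (reproK h0 h1 w) := by
  have ho := (orthonormal_fockE h0 h1).orthogonalFamily
  have hs := ho.hasSum_linearIsometry (hermiteBasis.repr (coherent h0 h1 w))
  simp only [HilbertBasis.repr_apply_apply, coe_hermiteBasis, LinearIsometry.toSpanSingleton_apply]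
    at hs
  suffices hE : reproK h0 h1 w = ho.linearIsometry (hermiteBasis.repr (coherent h0 h1 w)) by
    rw [hE]; exact hs
  obtain ⟨F, hF, hFe⟩ := (ho.linearIsometry (hermiteBasis.repr (coherent h0 h1 w))).2
  refine Subtype.ext (Lp.ext ((coeFn_reproK h0 h1 w).trans (EventuallyEq.trans ?_ hFe.symm)))
  refine ae_of_all _ fun z => ?_
  rw [← inner_reproK h0 h1 z _ hF hFe, inner_reproK_of_hasSum h0 h1 hs, inner_coherent_coherent]

/-- The functions `E_n` as a Hilbert basis of the Fock space. -/
def fockBasis {ε : ℝ} (h0 : 0 < ε) (h1 : ε < 1) : HilbertBasis ℕ ℂ (fockSpace ε) :=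
  HilbertBasis.mkOfOrthogonalEqBot (orthonormal_fockE h0 h1) (by
    rw [Submodule.eq_bot_iff]
    intro g hg
    have hn : ∀ n, inner ℂ (fockE h0 h1 n) g = 0 := fun n =>
      (Submodule.mem_orthogonal _ _).1 hg _ (Submodule.subset_span ⟨n, rfl⟩)
    obtain ⟨G, hG, hGe⟩ := g.2
    refine Subtype.ext ((Lp.eq_zero_iff_ae_eq_zero).2 (hGe.trans (ae_of_all _ fun w => ?_)))
    change G w = 0
    rw [← inner_reproK h0 h1 w g hG hGe]
    -- Since g is orthogonal to every term of the series for the reproducing kernel at w, it is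
    -- orthogonal to that kernel.
    have h2 := (hasSum_reproK h0 h1 w).mapL (innerSL ℂ g)
    have h3 : ∀ n, innerSL ℂ g (inner ℂ (hermiteL2 n) (coherent h0 h1 w) • fockE h0 h1 n) = 0 :=
      fun n => (inner_smul_right g (fockE h0 h1 n) _).trans (by
        rw [inner_eq_zero_symm.1 (hn n), mul_zero])
    simp only [h3] at h2
    exact inner_eq_zero_symm.1 (h2.unique hasSum_zero))

theorem coe_fockBasis {ε : ℝ} (h0 : 0 < ε) (h1 : ε < 1) : ⇑(fockBasis h0 h1) = fockE h0 h1 :=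
  HilbertBasis.coe_mkOfOrthogonalEqBot _ _

/-- The unitary map of `L²(ℝ)` onto the Fock space that maps `h_n` to `E_n`. -/
def fockV {ε : ℝ} (h0 : 0 < ε) (h1 : ε < 1) :
    Lp ℂ 2 (volume : Measure ℝ) ≃ₗᵢ[ℂ] fockSpace ε :=
  hermiteBasis.repr.trans (fockBasis h0 h1).repr.symm

theorem hasSum_fockV {ε : ℝ} (h0 : 0 < ε) (h1 : ε < 1) (f : Lp ℂ 2 (volume : Measure ℝ)) :
    HasSum (fun n => inner ℂ (hermiteL2 n) f • fockE h0 h1 n) (fockV h0 h1 f) := by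
  have := (fockBasis h0 h1).hasSum_repr_symm (hermiteBasis.repr f)
  simp only [HilbertBasis.repr_apply_apply, coe_hermiteBasis, coe_fockBasis] at this
  exact this

theorem fockV_hermiteL2 {ε : ℝ} (h0 : 0 < ε) (h1 : ε < 1) (n : ℕ) :
    fockV h0 h1 (hermiteL2 n) = fockE h0 h1 n := by
  rw [fockV, LinearIsometryEquiv.trans_apply, ← coe_hermiteBasis, HilbertBasis.repr_self,
    HilbertBasis.repr_symm_single, coe_fockBasis]

theorem coeFn_fockV {ε : ℝ} (h0 : 0 < ε) (h1 : ε < 1) (f : Lp ℂ 2 (volume : Measure ℝ)) :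
    (fockV h0 h1 f : Lp ℂ 2 (fockMeasure ε)) =ᵐ[fockMeasure ε]
      fun z => inner ℂ (coherent h0 h1 z) f := by
  obtain ⟨F, hF, hFe⟩ := (fockV h0 h1 f).2
  refine hFe.trans (ae_of_all _ fun z => ?_)
  simp only
  rw [← inner_reproK_of_hasSum h0 h1 (hasSum_fockV h0 h1 f) z, inner_reproK h0 h1 z _ hF hFe]

/-! ### Gaussian windowed Fourier transforms of Schwartz functions -/

/-- The integral `∫ P(y-p) e^{-a(y-p)² - iyq} f(y) dy`. -/
def windowInt (a : ℝ) (P : Polynomial ℤ) (f : 𝓢(ℝ, ℂ)) (p q : ℝ) : ℂ :=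
  ∫ y : ℝ, Polynomial.aeval ((y : ℂ) - p) P
    * Complex.exp (-a * ((y : ℂ) - p) ^ 2 - Complex.I * y * q) * f y

theorem norm_cexp_window (a p q y : ℝ) :
    ‖Complex.exp (-a * ((y : ℂ) - p) ^ 2 - Complex.I * y * q)‖ = Real.exp (-a * (y - p) ^ 2) := by
  rw [Complex.norm_exp]
  congr 1
  have : (-a * ((y : ℂ) - p) ^ 2 - Complex.I * y * q)
      = ((-a * (y - p) ^ 2 : ℝ) : ℂ) - ((y * q : ℝ) : ℂ) * Complex.I := by
    push_cast; ring
  rw [this, Complex.sub_re, Complex.ofReal_re, Complex.re_ofReal_mul, Complex.I_re, mul_zero,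
    sub_zero]

theorem integrable_window {a : ℝ} (ha : 0 < a) (P : Polynomial ℤ) (f : 𝓢(ℝ, ℂ)) (p q : ℝ) :
    Integrable fun y : ℝ => Polynomial.aeval ((y : ℂ) - p) P
      * Complex.exp (-a * ((y : ℂ) - p) ^ 2 - Complex.I * y * q) * f y := by
  obtain ⟨C, hC, h⟩ := aeval_bound P a ha
  have hc : Continuous fun y : ℝ => Polynomial.aeval ((y : ℂ) - p) P :=
    (Polynomial.continuous_aeval _).comp (by fun_prop)
  have hf := f.continuous
  refine (f.integrable.norm.const_mul C).mono' (by fun_prop) (ae_of_all _ fun y => ?_)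
  rw [norm_mul, norm_mul, norm_cexp_window]
  refine mul_le_mul_of_nonneg_right ?_ (norm_nonneg _)
  have := h ((y : ℂ) - p)
  rw [← Complex.ofReal_sub, Complex.norm_real, Real.norm_eq_abs, sq_abs] at this
  calc _ ≤ C * Real.exp (a * (y - p) ^ 2) * Real.exp (-a * (y - p) ^ 2) := by
        rw [← Complex.ofReal_sub]
        gcongr
    _ = C := by rw [mul_assoc, ← Real.exp_add]; simp

/-- Integration by parts in y: the frequency factor iq is traded for a derivative of f, of the
polynomial or of the Gaussian window. -/
theorem windowInt_mul_freq {a : ℝ} (ha : 0 < a) (P : Polynomial ℤ) (f : 𝓢(ℝ, ℂ)) (p q : ℝ) :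
    Complex.I * q * windowInt a P f p q
      = windowInt a P (SchwartzMap.derivCLM ℂ ℂ f) p q + windowInt a (Polynomial.derivative P) f p q
        - 2 * a * windowInt a (Polynomial.X * P) f p q := by
  have i1 := integrable_window ha P (SchwartzMap.derivCLM ℂ ℂ f) p q
  have i2 := integrable_window ha (Polynomial.derivative P) f p q
  have i3 := (integrable_window ha (Polynomial.X * P) f p q).const_mul (2 * a : ℂ)
  have i4 := (integrable_window ha P f p q)
  have i5 := i4.const_mul (Complex.I * q)
  have i12 := i1.add i2
  have i123 := i12.sub i3
  have i1235 := i123.sub i5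
  simp only [Pi.add_def, Pi.sub_def] at i12 i123 i1235
  rw [eq_comm, ← sub_eq_zero]
  simp only [windowInt]
  rw [← integral_const_mul, ← integral_const_mul, ← integral_add i1 i2, ← integral_sub i12 i3,
    ← integral_sub i123 i5]
  refine integral_eq_zero_of_hasDerivAt_of_integrable (fun y => ?_) i1235 i4
  have h1 : HasDerivAt (fun y : ℂ => Polynomial.aeval (y - p) P)
      (Polynomial.aeval ((y : ℂ) - p) (Polynomial.derivative P)) (y : ℂ) := by
    have := (Polynomial.hasDerivAt_aeval P ((y : ℂ) - p)).comp (y : ℂ)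
      ((hasDerivAt_id (y : ℂ)).sub_const (p : ℂ))
    simpa [Function.comp_def] using this
  have h2 : HasDerivAt (fun y : ℂ => Complex.exp (-a * (y - p) ^ 2 - Complex.I * y * q))
      (Complex.exp (-a * ((y : ℂ) - p) ^ 2 - Complex.I * y * q) *
        (-a * (2 * (y - p)) - Complex.I * q)) (y : ℂ) := by
    have := (((((hasDerivAt_id (y : ℂ)).sub_const (p : ℂ)).pow 2).const_mul (-a : ℂ)).sub
      (((hasDerivAt_id (y : ℂ)).const_mul Complex.I).mul_const (q : ℂ))).cexp
    simpa using this
  have h3 : HasDerivAt f (deriv f y) y := f.differentiableAt.hasDerivAt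
  refine (((h1.mul h2).comp_ofReal).mul h3).congr_deriv ?_
  simp only [map_mul, Polynomial.aeval_X, SchwartzMap.derivCLM_apply, Pi.mul_apply]
  ring

/-- Taking absolute values removes the phase and leaves, as a function of p, the convolution of |f|
with an integrable window. -/
theorem exists_norm_windowInt_le {a : ℝ} (ha : 0 < a) (P : Polynomial ℤ) (f : 𝓢(ℝ, ℂ)) :
    ∃ D : ℝ → ℝ, Integrable D ∧ ∀ p q, ‖windowInt a P f p q‖ ≤ D p := by
  have hb : (-a : ℂ).re < 0 := by simpa using ha
  have hw : Integrable fun t : ℝ => ‖Polynomial.aeval (-t : ℂ) P * Complex.exp (-a * t ^ 2)‖ := by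
    have := (integrable_aeval_mul_cexp P hb 0).comp_neg.norm
    simpa using this
  have hconv := (f.integrable (μ := volume)).norm.convolution_integrand
    (ContinuousLinearMap.mul ℝ ℝ) hw
  refine ⟨_, hconv.integral_prod_left, fun p q => ?_⟩
  rw [windowInt]
  refine (norm_integral_le_integral_norm _).trans (le_of_eq ?_)
  refine integral_congr_ae (ae_of_all _ fun y => ?_)
  simp only [ContinuousLinearMap.mul_apply']
  rw [norm_mul, norm_mul, norm_mul, norm_cexp_window, mul_comm, Complex.norm_exp]
  congr 3
  · push_cast; ring_nf
  · rw [← Complex.ofReal_pow, ← Complex.ofReal_neg, ← Complex.ofReal_mul, Complex.ofReal_re]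
    ring

/-- Two integrations by parts express q² times the transform through windowed transforms of f'', f'
and f, each bounded by an integrable function of p. The gain (1 + q²)⁻¹ supplies absolute
convergence in the momentum variable. -/
theorem exists_norm_windowInt_le_decay {a : ℝ} (ha : 0 < a) (f : 𝓢(ℝ, ℂ)) :
    ∃ D : ℝ → ℝ, Integrable D ∧ ∀ p q, ‖windowInt a 1 f p q‖ ≤ D p * (1 + q ^ 2)⁻¹ := by
  set f' := SchwartzMap.derivCLM ℂ ℂ f
  obtain ⟨D0, i0, h0⟩ := exists_norm_windowInt_le ha 1 f
  obtain ⟨D1, i1, h1⟩ := exists_norm_windowInt_le ha 1 (SchwartzMap.derivCLM ℂ ℂ f')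
  obtain ⟨D2, i2, h2⟩ := exists_norm_windowInt_le ha Polynomial.X f'
  obtain ⟨D3, i3, h3⟩ := exists_norm_windowInt_le ha (Polynomial.X * Polynomial.X) f
  refine ⟨fun p => D0 p + (D1 p + 4 * a * D2 p + 2 * a * D0 p + 4 * a ^ 2 * D3 p),
    i0.add (((i1.add (i2.const_mul _)).add (i0.const_mul _)).add (i3.const_mul _)),
    fun p q => ?_⟩
  rw [← div_eq_mul_inv, le_div_iff₀ (by positivity), mul_add, mul_one]
  refine add_le_add (h0 p q) ?_
  have e1 := windowInt_mul_freq ha 1 f p q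
  have e2 := windowInt_mul_freq ha 1 f' p q
  have e3 := windowInt_mul_freq ha Polynomial.X f p q
  have e0 : ∀ g, windowInt a 0 g p q = 0 := fun g => by simp [windowInt]
  rw [Polynomial.derivative_one, mul_one, e0] at e1 e2
  rw [Polynomial.derivative_X] at e3
  have key : windowInt a 1 f p q * ((q ^ 2 : ℝ) : ℂ)
      = -(windowInt a 1 (SchwartzMap.derivCLM ℂ ℂ f') p q)
        + ((4 * a : ℝ) : ℂ) * windowInt a Polynomial.X f' p q
        + ((2 * a : ℝ) : ℂ) * windowInt a 1 f p q
        - ((4 * a ^ 2 : ℝ) : ℂ) * windowInt a (Polynomial.X * Polynomial.X) f p q := by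
    push_cast
    linear_combination (-(Complex.I * q)) * e1 - e2 + 2 * a * e3
      + (q ^ 2 * windowInt a 1 f p q) * Complex.I_sq
  have := congrArg norm key
  rw [norm_mul, Complex.norm_real, Real.norm_of_nonneg (sq_nonneg q)] at this
  rw [this]
  refine (norm_sub_le _ _).trans (add_le_add ((norm_add_le _ _).trans (add_le_add
    ((norm_add_le _ _).trans (add_le_add ?_ ?_)) ?_)) ?_)
  · rw [norm_neg]; exact h1 p q
  · rw [norm_mul, Complex.norm_real, Real.norm_of_nonneg (by positivity)]
    exact mul_le_mul_of_nonneg_left (h2 p q) (by positivity)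
  · rw [norm_mul, Complex.norm_real, Real.norm_of_nonneg (by positivity)]
    exact mul_le_mul_of_nonneg_left (h0 p q) (by positivity)
  · rw [norm_mul, Complex.norm_real, Real.norm_of_nonneg (by positivity)]
    exact mul_le_mul_of_nonneg_left (h3 p q) (by positivity)

theorem stronglyMeasurable_windowInt (a : ℝ) (P : Polynomial ℤ) (f : 𝓢(ℝ, ℂ)) :
    StronglyMeasurable fun v : ℝ × ℝ => windowInt a P f v.1 v.2 := by
  unfold windowInt
  have hc : Continuous fun v : (ℝ × ℝ) × ℝ => Polynomial.aeval ((v.2 : ℂ) - v.1.1) P :=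
    (Polynomial.continuous_aeval _).comp (by fun_prop)
  have hf : Continuous fun v : (ℝ × ℝ) × ℝ => f v.2 := f.continuous.comp continuous_snd
  refine StronglyMeasurable.integral_prod_right (f := fun (v : ℝ × ℝ) (y : ℝ) =>
    Polynomial.aeval ((y : ℂ) - v.1) P
    * Complex.exp (-a * ((y : ℂ) - v.1) ^ 2 - Complex.I * y * v.2) * f y)
    (Continuous.stronglyMeasurable ?_)
  unfold Function.uncurry
  fun_prop

/-! ### Product integrands on the plane -/

theorem integrable_re_mul_im {u v : ℝ → ℝ} (hu : Integrable u) (hv : Integrable v) :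
    Integrable fun z : ℂ => u z.re * v z.im := by
  have h := hu.mul_prod hv
  rw [← Measure.volume_eq_prod] at h
  exact (Complex.volume_preserving_equiv_real_prod.integrable_comp_emb
    Complex.measurableEquivRealProd.measurableEmbedding).2 h

theorem integral_re_mul_im (u v : ℝ → ℝ) :
    ∫ z : ℂ, u z.re * v z.im = (∫ r, u r) * ∫ s, v s := by
  rw [← integral_prod_mul, ← Measure.volume_eq_prod,
    ← Complex.volume_preserving_equiv_real_prod.integral_comp
      Complex.measurableEquivRealProd.measurableEmbedding]
  rfl

/-! ### Phase space coordinates -/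

/-- The scaling `(1+ε)/(2√ε)` of the position variable. -/
def posScale (ε : ℝ) : ℝ := (1 + ε) / (2 * √ε)

/-- The scaling `(1-ε)/(2√ε)` of the momentum variable. -/
def momScale (ε : ℝ) : ℝ := (1 - ε) / (2 * √ε)

theorem posScale_pos {ε : ℝ} (h0 : 0 < ε) : 0 < posScale ε :=
  div_pos (by positivity) (by positivity)

theorem momScale_pos {ε : ℝ} (h0 : 0 < ε) (h1 : ε < 1) : 0 < momScale ε :=
  div_pos (by linarith) (by positivity)

theorem posScale_mul_momScale {ε : ℝ} (h0 : 0 < ε) :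
    posScale ε * momScale ε = (1 - ε ^ 2) / (4 * ε) := by
  have := Real.mul_self_sqrt h0.le
  rw [posScale, momScale, div_mul_div_comm, mul_mul_mul_comm, this]
  ring

theorem fockRate_eq {ε : ℝ} (h0 : 0 < ε) :
    fockRate ε = 1 / (2 * (posScale ε * momScale ε)) := by
  rw [posScale_mul_momScale h0, fockRate]
  field_simp
  norm_num

/-- In terms of A = `posScale ε` and B = `momScale ε` the exponent is -z²/(4AB) - Ax²/(2B) + zx/B,
the form in which it is compared with the heat kernel of rate 1/(AB). -/
theorem fockKernel_eq {ε : ℝ} (h0 : 0 < ε) (h1 : ε < 1) (z : ℂ) (x : ℝ) :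
    fockKernel ε z x = kernelCoeff ε * Complex.exp (-(1 / (4 * (posScale ε * momScale ε))) * z ^ 2
      - posScale ε / (2 * momScale ε) * x ^ 2 + z * x / momScale ε) := by
  have hs : √ε ≠ 0 := by positivity
  have h1' : 1 - ε ≠ 0 := by linarith
  have e1 : posScale ε / (2 * momScale ε) = (1 + ε) / (1 - ε) / 2 := by
    rw [posScale, momScale]; field_simp
  have e2 : (2 * √ε / (1 - ε)) = 1 / momScale ε := by
    rw [momScale]; field_simp
  rw [fockKernel, mul_assoc, ← Complex.exp_add, ← e1, e2, fockRate_eq h0]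
  congr 2
  push_cast
  ring

theorem sq_kernelCoeff_eq {ε : ℝ} (h0 : 0 < ε) (h1 : ε < 1) :
    kernelCoeff ε ^ 2 = 1 / (2 * Real.pi) * (1 / (Real.pi * (posScale ε * momScale ε)))
      * √(Real.pi * posScale ε / momScale ε) := by
  have hA := posScale_pos h0
  have hB := momScale_pos h0 h1
  have h1' : 0 < 1 - ε := by linarith
  have e1 : (1 + ε) / (1 - ε) = posScale ε / momScale ε := by
    rw [posScale, momScale]; field_simp
  have h := sq_kernelCoeff h0 h1
  rw [e1, fockRate_eq h0] at h
  have hne : √(Real.pi / (posScale ε / momScale ε)) ≠ 0 := by positivity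
  have h2 : √(Real.pi * posScale ε / momScale ε) * √(Real.pi / (posScale ε / momScale ε))
      = Real.pi := by
    rw [← Real.sqrt_mul (by positivity)]
    rw [show Real.pi * posScale ε / momScale ε * (Real.pi / (posScale ε / momScale ε))
      = Real.pi ^ 2 by field_simp, Real.sqrt_sq Real.pi_pos.le]
  refine mul_right_cancel₀ hne ?_
  rw [h, mul_assoc, h2]
  field_simp

theorem sq_norm_eq (z : ℂ) : ‖z‖ ^ 2 = z.re ^ 2 + z.im ^ 2 := by
  rw [Complex.sq_norm, Complex.normSq_apply]; ring

/-- The weighted pairing of a Schwartz function with a coherent state is a windowed Fourier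
transform. -/
theorem integral_fockKernel_mul_exp {ε : ℝ} (h0 : 0 < ε) (h1 : ε < 1) (f : 𝓢(ℝ, ℂ)) (z : ℂ) :
    (∫ x, fockKernel ε z x * f x) * (Real.exp (-(fockRate ε / 2 * ‖z‖ ^ 2)) : ℂ)
      = kernelCoeff ε * Complex.exp ((-(z.re * z.im / (2 * (posScale ε * momScale ε))) : ℝ)
        * Complex.I) * windowInt (posScale ε / (2 * momScale ε)) 1 f (z.re / posScale ε)
          (-(z.im / momScale ε)) := by
  have hA : (posScale ε : ℂ) ≠ 0 := by exact_mod_cast (posScale_pos h0).ne'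
  have hB : (momScale ε : ℂ) ≠ 0 := by exact_mod_cast (momScale_pos h0 h1).ne'
  rw [windowInt, ← integral_mul_const, ← integral_const_mul]
  refine integral_congr_ae (ae_of_all _ fun y => ?_)
  simp only [map_one, one_mul]
  rw [fockKernel_eq h0 h1, Complex.ofReal_exp]
  have key : Complex.exp (-(1 / (4 * (posScale ε * momScale ε))) * z ^ 2
      - posScale ε / (2 * momScale ε) * y ^ 2 + z * y / momScale ε)
      * Complex.exp ((-(fockRate ε / 2 * ‖z‖ ^ 2) : ℝ) : ℂ)
      = Complex.exp ((-(z.re * z.im / (2 * (posScale ε * momScale ε))) : ℝ) * Complex.I)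
      * Complex.exp (-((posScale ε / (2 * momScale ε) : ℝ) : ℂ)
        * ((y : ℂ) - ((z.re / posScale ε : ℝ) : ℂ)) ^ 2
        - Complex.I * y * ((-(z.im / momScale ε) : ℝ) : ℂ)) := by
    rw [← Complex.exp_add, ← Complex.exp_add, fockRate_eq h0, sq_norm_eq]
    congr 1
    have hz : z = z.re + z.im * Complex.I := (Complex.re_add_im z).symm
    generalize z.re = r at *
    generalize z.im = s at *
    rw [hz]
    push_cast
    field_simp
    linear_combination (-4 * (s : ℂ) ^ 2) * Complex.I_sq
  linear_combination (kernelCoeff ε * f y) * key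

/-- Completing the square, the kernel times the square root of the weight has modulus |`kernelCoeff
ε`| e^{-(Re z - Ax)²/(2AB)}, where A = `posScale ε` and B = `momScale ε`. -/
theorem norm_fockKernel_mul_exp_le {ε : ℝ} (h0 : 0 < ε) (h1 : ε < 1) (z : ℂ) (x : ℝ) :
    ‖fockKernel ε z x‖ * Real.exp (-(fockRate ε / 2 * ‖z‖ ^ 2)) ≤ |kernelCoeff ε| := by
  have hA := posScale_pos h0
  have hB := momScale_pos h0 h1
  rw [fockKernel_eq h0 h1, norm_mul, Complex.norm_real, Real.norm_eq_abs, mul_assoc,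
    Complex.norm_exp, ← Real.exp_add]
  refine mul_le_of_le_one_right (abs_nonneg _) (Real.exp_le_one_iff.2 ?_)
  have e : (-(1 / (4 * (posScale ε * momScale ε))) * z ^ 2
      - posScale ε / (2 * momScale ε) * x ^ 2 + z * x / momScale ε : ℂ).re
      = -(1 / (4 * (posScale ε * momScale ε))) * (z.re ^ 2 - z.im ^ 2)
      - posScale ε / (2 * momScale ε) * x ^ 2 + z.re * x / momScale ε := by
    have e' : (-(1 / (4 * (posScale ε * momScale ε))) * z ^ 2
      - posScale ε / (2 * momScale ε) * x ^ 2 + z * x / momScale ε : ℂ)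
      = ((-(1 / (4 * (posScale ε * momScale ε))) : ℝ) : ℂ) * z ^ 2
      - ((posScale ε / (2 * momScale ε) * x ^ 2 : ℝ) : ℂ) + ((x / momScale ε : ℝ) : ℂ) * z := by
      push_cast; ring
    rw [e', Complex.add_re, Complex.sub_re, Complex.re_ofReal_mul, Complex.re_ofReal_mul,
      Complex.ofReal_re, sq z, Complex.mul_re]
    ring
  rw [e, fockRate_eq h0, sq_norm_eq]
  have : -(1 / (4 * (posScale ε * momScale ε))) * (z.re ^ 2 - z.im ^ 2)
      - posScale ε / (2 * momScale ε) * x ^ 2 + z.re * x / momScale ε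
      + -(1 / (2 * (posScale ε * momScale ε)) / 2 * (z.re ^ 2 + z.im ^ 2))
      = -(1 / (2 * (posScale ε * momScale ε)) * (z.re - posScale ε * x) ^ 2) := by
    field_simp
    ring
  rw [this]
  have : 0 ≤ 1 / (2 * (posScale ε * momScale ε)) * (z.re - posScale ε * x) ^ 2 := by positivity
  linarith

theorem continuous_fockKernel (ε : ℝ) : Continuous fun v : ℂ × ℝ => fockKernel ε v.1 v.2 := by
  unfold fockKernel
  fun_prop

/-! ### The kernel of a Toeplitz operator -/

/-- The integrand of the integral operator on `L²(ℝ)` that corresponds to a Toeplitz operator. -/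
def toeplitzIntegrand (ε : ℝ) (φ : ℂ → ℂ) (f : ℝ → ℂ) (x : ℝ) (z : ℂ) : ℂ :=
  φ z * fockKernel ε ((starRingEnd ℂ) z) x * (∫ y, fockKernel ε z y * f y)
    * (Real.exp (-(fockRate ε * ‖z‖ ^ 2)) : ℂ)

theorem exists_norm_le_of_memLp_top {φ : ℂ → ℂ} (hφ : MemLp φ ∞ (volume : Measure ℂ)) :
    ∃ M : ℝ, 0 ≤ M ∧ ∀ᵐ z, ‖φ z‖ ≤ M := by
  refine ⟨(eLpNorm φ ∞ volume).toReal, ENNReal.toReal_nonneg, ?_⟩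
  have h := hφ.2
  rw [eLpNorm_exponent_top] at h ⊢
  filter_upwards [ae_le_eLpNormEssSup (f := φ) (μ := volume)] with z hz
  rw [← toReal_enorm]
  exact ENNReal.toReal_mono h.ne hz

/-- The Gaussian weight is split evenly. One half bounds k(z̄,x) uniformly; the other turns the
transform of f into a windowed Fourier transform, which is dominated by an integrable function of Re
z times one of Im z. The factor g and the measure ν serve two uses: a test function on the line, and
the constant 1 on a compact set. -/
theorem integrable_toeplitzIntegrand {ε : ℝ} (h0 : 0 < ε) (h1 : ε < 1) {φ : ℂ → ℂ}
    (hφ : MemLp φ ∞ (volume : Measure ℂ)) (f : 𝓢(ℝ, ℂ)) (ν : Measure ℝ) [SFinite ν] {g : ℝ → ℂ}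
    (hg : Integrable g ν) :
    Integrable (Function.uncurry fun x z => g x * toeplitzIntegrand ε φ f x z)
      (ν.prod volume) := by
  obtain ⟨M, hM, hφM⟩ := exists_norm_le_of_memLp_top hφ
  have hA := posScale_pos h0
  have hB := momScale_pos h0 h1
  obtain ⟨D, hD, hDb⟩ := exists_norm_windowInt_le_decay
    (a := posScale ε / (2 * momScale ε)) (by positivity) f
  have hT : StronglyMeasurable fun z : ℂ => ∫ y, fockKernel ε z y * f y := by
    have hf : Continuous fun v : ℂ × ℝ => f v.2 := f.continuous.comp continuous_snd
    refine StronglyMeasurable.integral_prod_right (f := fun (z : ℂ) (y : ℝ) =>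
      fockKernel ε z y * f y) (Continuous.stronglyMeasurable ?_)
    exact (continuous_fockKernel ε).mul hf
  have hbd : Integrable fun z : ℂ => D (z.re / posScale ε) * (1 + (z.im / momScale ε) ^ 2)⁻¹ :=
    integrable_re_mul_im (hD.comp_div hA.ne')
      (integrable_inv_one_add_sq.comp_div hB.ne')
  have hprod := hg.norm.mul_prod (hbd.const_mul (M * |kernelCoeff ε| * |kernelCoeff ε|))
  refine hprod.mono' ?_ ?_
  · have m1 : AEStronglyMeasurable (fun v : ℝ × ℂ => g v.1) (ν.prod volume) :=
      hg.aestronglyMeasurable.comp_fst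
    have m2 : AEStronglyMeasurable (fun v : ℝ × ℂ => φ v.2) (ν.prod volume) :=
      hφ.1.comp_snd
    have m3 : AEStronglyMeasurable (fun v : ℝ × ℂ => ∫ y, fockKernel ε v.2 y * f y)
      (ν.prod volume) := hT.aestronglyMeasurable.comp_snd
    have m4 : Continuous fun v : ℝ × ℂ => fockKernel ε ((starRingEnd ℂ) v.2) v.1 :=
      Continuous.comp (g := fun v : ℂ × ℝ => fockKernel ε v.1 v.2)
        (f := fun v : ℝ × ℂ => ((starRingEnd ℂ) v.2, v.1)) (continuous_fockKernel ε)
        ((Complex.continuous_conj.comp continuous_snd).prodMk continuous_fst)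
    have m5 : Continuous fun v : ℝ × ℂ => (Real.exp (-(fockRate ε * ‖v.2‖ ^ 2)) : ℂ) := by
      fun_prop
    exact m1.mul (((m2.mul m4.aestronglyMeasurable).mul m3).mul m5.aestronglyMeasurable)
  · have h2 : ∀ᵐ v : ℝ × ℂ ∂(ν.prod volume), ‖φ v.2‖ ≤ M :=
      Measure.quasiMeasurePreserving_snd.ae hφM
    filter_upwards [h2] with v hv
    obtain ⟨x, z⟩ := v
    simp only [Function.uncurry] at hv ⊢
    rw [norm_mul]
    refine mul_le_mul_of_nonneg_left ?_ (norm_nonneg _)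
    have e : (Real.exp (-(fockRate ε * ‖z‖ ^ 2)) : ℂ)
        = (Real.exp (-(fockRate ε / 2 * ‖z‖ ^ 2)) : ℂ)
          * (Real.exp (-(fockRate ε / 2 * ‖z‖ ^ 2)) : ℂ) := by
      rw [← Complex.ofReal_mul, ← Real.exp_add]
      congr 2
      ring
    have k1 := norm_fockKernel_mul_exp_le h0 h1 ((starRingEnd ℂ) z) x
    rw [RCLike.norm_conj] at k1
    have k2 : ‖(∫ y, fockKernel ε z y * f y) * (Real.exp (-(fockRate ε / 2 * ‖z‖ ^ 2)) : ℂ)‖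
        ≤ |kernelCoeff ε| * (D (z.re / posScale ε) * (1 + (z.im / momScale ε) ^ 2)⁻¹) := by
      rw [integral_fockKernel_mul_exp h0 h1, norm_mul, norm_mul, Complex.norm_real,
        Complex.norm_exp_ofReal_mul_I, mul_one, Real.norm_eq_abs]
      refine mul_le_mul_of_nonneg_left ?_ (abs_nonneg _)
      have := hDb (z.re / posScale ε) (-(z.im / momScale ε))
      rwa [neg_sq] at this
    rw [norm_mul, Complex.norm_real, Real.norm_of_nonneg (Real.exp_pos _).le] at k2
    rw [toeplitzIntegrand, e, norm_mul, norm_mul, norm_mul, norm_mul, Complex.norm_real,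
      Real.norm_of_nonneg (Real.exp_pos _).le]
    calc _ = ‖φ z‖ * (‖fockKernel ε ((starRingEnd ℂ) z) x‖
          * Real.exp (-(fockRate ε / 2 * ‖z‖ ^ 2)))
          * (‖∫ y, fockKernel ε z y * f y‖ * Real.exp (-(fockRate ε / 2 * ‖z‖ ^ 2))) := by ring
      _ ≤ M * |kernelCoeff ε| *
          (|kernelCoeff ε| * (D (z.re / posScale ε) * (1 + (z.im / momScale ε) ^ 2)⁻¹)) := by
        gcongr
      _ = _ := by ring

theorem locallyIntegrable_integral_toeplitzIntegrand {ε : ℝ} (h0 : 0 < ε) (h1 : ε < 1) {φ : ℂ → ℂ}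
    (hφ : MemLp φ ∞ (volume : Measure ℂ)) (f : 𝓢(ℝ, ℂ)) :
    LocallyIntegrable (fun x => ∫ z, toeplitzIntegrand ε φ f x z) volume := by
  refine (locallyIntegrable_iff).2 fun K hK => ?_
  have hfin : IsFiniteMeasure ((volume : Measure ℝ).restrict K) :=
    ⟨by rw [Measure.restrict_apply_univ]; exact hK.measure_lt_top⟩
  have := (integrable_toeplitzIntegrand h0 h1 hφ f (volume.restrict K)
    (integrable_const (1 : ℂ))).integral_prod_left
  simpa [IntegrableOn, Function.uncurry] using this

/-- The projection in the Toeplitz operator disappears because it is paired with Vg, an element of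
the Fock space. -/
theorem inner_toeplitz {ε : ℝ} (h0 : 0 < ε) (h1 : ε < 1) {φ : ℂ → ℂ}
    (hφ : MemLp φ ∞ (volume : Measure ℂ)) (f g : Lp ℂ 2 (volume : Measure ℝ)) :
    inner ℂ g (ContinuousLinearMap.adjoint
      (fockV h0 h1 : Lp ℂ 2 (volume : Measure ℝ) →L[ℂ] fockSpace ε)
        (toeplitz ε φ hφ (fockV h0 h1 f)))
      = ∫ z, φ z * inner ℂ (coherent h0 h1 z) f * (starRingEnd ℂ) (inner ℂ (coherent h0 h1 z) g)
        * (Real.exp (-(fockRate ε * ‖z‖ ^ 2)) : ℂ) := by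
  rw [ContinuousLinearMap.adjoint_inner_right, ← integral_fockMeasure]
  have e1 : inner ℂ (fockV h0 h1 g) (toeplitz ε φ hφ (fockV h0 h1 f))
      = inner ℂ (fockV h0 h1 g : Lp ℂ 2 (fockMeasure ε))
        (ContinuousLinearMap.holderL (fockMeasure ε) ∞ 2 2 (ContinuousLinearMap.mul ℂ ℂ)
          ((memLp_top_fockMeasure ε hφ).toLp φ) (fockV h0 h1 f : Lp ℂ 2 (fockMeasure ε))) :=
    Submodule.inner_orthogonalProjectionOnto_eq_of_mem_left _ _
  refine e1.trans ?_
  rw [L2.inner_def]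
  refine integral_congr_ae ?_
  have e2 := ContinuousLinearMap.coeFn_holder (r := 2) (ContinuousLinearMap.mul ℂ ℂ)
    ((memLp_top_fockMeasure ε hφ).toLp φ) (fockV h0 h1 f : Lp ℂ 2 (fockMeasure ε))
  filter_upwards [e2, coeFn_fockV h0 h1 f, coeFn_fockV h0 h1 g,
    (memLp_top_fockMeasure ε hφ).coeFn_toLp] with z a1 a2 a3 a4
  rw [ContinuousLinearMap.holderL_apply_apply, a1, a2, a3, a4, RCLike.inner_apply,
    ContinuousLinearMap.mul_apply']

theorem inner_coherent_toLp {ε : ℝ} (h0 : 0 < ε) (h1 : ε < 1) (z : ℂ) (f : 𝓢(ℝ, ℂ)) :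
    inner ℂ (coherent h0 h1 z) (f.toLp 2) = ∫ y, fockKernel ε z y * f y :=
  inner_coherent h0 h1 z (f.coeFn_toLp 2 volume)

theorem inner_toLp_left (g : 𝓢(ℝ, ℂ)) (u : Lp ℂ 2 (volume : Measure ℝ)) :
    inner ℂ (g.toLp 2) u = ∫ x, (starRingEnd ℂ) (g x) * u x := by
  rw [L2.inner_def]
  refine integral_congr_ae ?_
  have h := g.coeFn_toLp 2 (volume : Measure ℝ)
  filter_upwards [h] with x hx
  rw [hx, RCLike.inner_apply, mul_comm]

/-- Both sides are locally integrable, so it is enough to pair them with real smooth functions of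
compact support. There the weak form `inner_toeplitz` and Fubini give the claim. -/
theorem coeFn_adjoint_toeplitz {ε : ℝ} (h0 : 0 < ε) (h1 : ε < 1) {φ : ℂ → ℂ}
    (hφ : MemLp φ ∞ (volume : Measure ℂ)) (f : 𝓢(ℝ, ℂ)) :
    (ContinuousLinearMap.adjoint
      (fockV h0 h1 : Lp ℂ 2 (volume : Measure ℝ) →L[ℂ] fockSpace ε)
        (toeplitz ε φ hφ (fockV h0 h1 (f.toLp 2))))
      =ᵐ[volume] fun x => ∫ z, toeplitzIntegrand ε φ f x z := by
  have hinner := inner_toeplitz h0 h1 hφ (f.toLp 2)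
  generalize (ContinuousLinearMap.adjoint
      (fockV h0 h1 : Lp ℂ 2 (volume : Measure ℝ) →L[ℂ] fockSpace ε)
        (toeplitz ε φ hφ (fockV h0 h1 (f.toLp 2)))) = u at hinner ⊢
  refine ae_eq_of_integral_contDiff_smul_eq ((Lp.memLp u).locallyIntegrable (by norm_num))
    (locallyIntegrable_integral_toeplitzIntegrand h0 h1 hφ f) fun g hg hgs => ?_
  have hgs' : HasCompactSupport fun x => (g x : ℂ) :=
    hgs.comp_left (g := fun t : ℝ => (t : ℂ)) (by simp)
  obtain ⟨G, hGg⟩ : ∃ G : 𝓢(ℝ, ℂ), ∀ x, G x = (g x : ℂ) :=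
    ⟨hgs'.toSchwartzMap (Complex.ofRealCLM.contDiff.comp hg), fun x => rfl⟩
  have hcG : ∀ z, (starRingEnd ℂ) (inner ℂ (coherent h0 h1 z) (G.toLp 2))
      = ∫ x, G x * fockKernel ε ((starRingEnd ℂ) z) x := by
    intro z
    rw [inner_coherent_toLp, ← integral_conj]
    refine integral_congr_ae (ae_of_all _ fun x => ?_)
    simp only [map_mul, conj_fockKernel, hGg, Complex.conj_ofReal]
    rw [mul_comm]
  have key := hinner (G.toLp 2)
  rw [inner_toLp_left] at key
  have hi := integrable_toeplitzIntegrand h0 h1 hφ f volume (G.integrable (μ := volume))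
  have hswap := integral_integral_swap hi
  have hconj : ∀ x, (starRingEnd ℂ) (G x) = G x := fun x => by rw [hGg, Complex.conj_ofReal]
  simp only [hconj] at key
  simp only [Complex.real_smul, ← hGg]
  simp only [integral_const_mul] at hswap
  rw [key, hswap]
  refine integral_congr_ae (ae_of_all _ fun z => ?_)
  simp only [hcG, toeplitzIntegrand]
  rw [inner_coherent_toLp]
  rw [← integral_const_mul, ← integral_mul_const]
  refine integral_congr_ae (ae_of_all _ fun x => ?_)
  simp only
  ring

/-! ### Weyl operators with heat-regularized symbols -/

/-- The integrand, over the plane, of the integrand of the Weyl operator. -/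
def weylHeatIntegrand (ε : ℝ) (φ : ℂ → ℂ) (f : ℝ → ℂ) (x ξ y : ℝ) (z : ℂ) : ℂ :=
  φ z * (Real.exp (-(‖z - ((posScale ε : ℂ) * (((x + y) / 2 : ℝ) : ℂ)
    - (momScale ε : ℂ) * Complex.I * ξ)‖ ^ 2 / (posScale ε * momScale ε))) : ℂ)
    * (Complex.exp (Complex.I * ((x : ℂ) - y) * ξ) * f y)

theorem weylIntegrand_weylSymbol {ε : ℝ} (h0 : 0 < ε) (φ : ℂ → ℂ) (f : ℝ → ℂ) (x ξ y : ℝ) :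
    weylIntegrand (weylSymbol ε φ) f x ξ y = (1 / (Real.pi * (posScale ε * momScale ε)) : ℝ)
      * ∫ z, weylHeatIntegrand ε φ f x ξ y z := by
  have e : 4 * ((1 - ε ^ 2) / (16 * ε)) = posScale ε * momScale ε := by
    rw [posScale_mul_momScale h0]
    field_simp
    ring
  have e' : 4 * Real.pi * ((1 - ε ^ 2) / (16 * ε)) = Real.pi * (posScale ε * momScale ε) := by
    rw [← e]; ring
  simp only [weylIntegrand, weylSymbol, heat, weylHeatIntegrand, e, e']
  rw [integral_mul_const, mul_assoc, mul_assoc]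
  rfl

theorem norm_cexp_I_mul (x y ξ : ℝ) : ‖Complex.exp (Complex.I * ((x : ℂ) - y) * ξ)‖ = 1 := by
  rw [show Complex.I * ((x : ℂ) - y) * ξ = (((x - y) * ξ : ℝ) : ℂ) * Complex.I by push_cast; ring,
    Complex.norm_exp_ofReal_mul_I]

/-- The integral of the Gaussian over z does not depend on its centre, which leaves |f(y)|. The
variable ξ has to stay fixed: for φ = 1 and f ≠ 0 the absolute integral over (y,z) is a positive
constant in ξ. -/
theorem integrable_weylHeatIntegrand {ε : ℝ} (h0 : 0 < ε) (h1 : ε < 1) {φ : ℂ → ℂ}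
    (hφ : MemLp φ ∞ (volume : Measure ℂ)) (f : 𝓢(ℝ, ℂ)) (x ξ : ℝ) :
    Integrable (Function.uncurry (weylHeatIntegrand ε φ f x ξ)) (volume.prod volume) := by
  obtain ⟨M, hM, hφM⟩ := exists_norm_le_of_memLp_top hφ
  have hA := posScale_pos h0
  have hB := momScale_pos h0 h1
  have hf := f.continuous
  set c : ℝ → ℂ := fun y => (posScale ε : ℂ) * (((x + y) / 2 : ℝ) : ℂ)
    - (momScale ε : ℂ) * Complex.I * ξ with hc
  have hcc : Continuous c := by simp only [hc]; fun_prop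
  have hgauss : Integrable fun z : ℂ => Real.exp (-(‖z‖ ^ 2 / (posScale ε * momScale ε))) := by
    refine (integrable_exp_neg_mul_sq_norm (b := 1 / (posScale ε * momScale ε))
      (by positivity)).congr (ae_of_all _ fun z => ?_)
    simp only
    congr 2
    ring
  have hdom : Integrable (fun v : ℝ × ℂ => M * ‖f v.1‖
      * Real.exp (-(‖v.2 - c v.1‖ ^ 2 / (posScale ε * momScale ε)))) (volume.prod volume) := by
    rw [integrable_prod_iff (by fun_prop)]
    refine ⟨ae_of_all _ fun y => (hgauss.comp_sub_right (c y)).const_mul (M * ‖f y‖), ?_⟩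
    have : ∀ y : ℝ, ∫ z : ℂ, ‖M * ‖f y‖
        * Real.exp (-(‖z - c y‖ ^ 2 / (posScale ε * momScale ε)))‖
        = M * ‖f y‖ * ∫ z : ℂ, Real.exp (-(‖z‖ ^ 2 / (posScale ε * momScale ε))) := by
      intro y
      rw [← integral_sub_right_eq_self
        (fun z : ℂ => Real.exp (-(‖z‖ ^ 2 / (posScale ε * momScale ε)))) (c y), ← integral_const_mul]
      refine integral_congr_ae (ae_of_all _ fun z => ?_)
      simp only
      rw [Real.norm_of_nonneg (by positivity)]
    simp only [this]
    exact (f.integrable.norm.const_mul M).mul_const _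
  refine hdom.mono' ?_ ?_
  · have m2 : AEStronglyMeasurable (fun v : ℝ × ℂ => φ v.2) (volume.prod volume) := hφ.1.comp_snd
    have m3 : Continuous fun v : ℝ × ℂ =>
        (Real.exp (-(‖v.2 - c v.1‖ ^ 2 / (posScale ε * momScale ε))) : ℂ) := by fun_prop
    have m4 : Continuous fun v : ℝ × ℂ =>
        Complex.exp (Complex.I * ((x : ℂ) - v.1) * ξ) * f v.1 := by fun_prop
    exact (m2.mul m3.aestronglyMeasurable).mul m4.aestronglyMeasurable
  · have h2 : ∀ᵐ v : ℝ × ℂ ∂((volume : Measure ℝ).prod volume), ‖φ v.2‖ ≤ M :=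
      Measure.quasiMeasurePreserving_snd.ae hφM
    filter_upwards [h2] with v hv
    obtain ⟨y, z⟩ := v
    simp only [Function.uncurry] at hv ⊢
    rw [weylHeatIntegrand, norm_mul, norm_mul, norm_mul, norm_cexp_I_mul, one_mul,
      Complex.norm_real, Real.norm_of_nonneg (Real.exp_pos _).le]
    calc _ ≤ M * Real.exp (-(‖z - c y‖ ^ 2 / (posScale ε * momScale ε))) * ‖f y‖ := by
          gcongr
      _ = _ := by ring

/-- The integral of `weylHeatIntegrand` over `y`. -/
def weylPlaneIntegrand (ε : ℝ) (φ : ℂ → ℂ) (f : 𝓢(ℝ, ℂ)) (x ξ : ℝ) (z : ℂ) : ℂ :=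
  φ z * ((Real.exp (-((z.im + momScale ε * ξ) ^ 2 / (posScale ε * momScale ε))) : ℂ)
    * Complex.exp (Complex.I * x * ξ)
    * windowInt (posScale ε / (4 * momScale ε)) 1 f (2 * z.re / posScale ε - x) ξ)

/-- The heat Gaussian factors into its real and imaginary parts. The real one, (Re z -
A(x+y)/2)²/(AB), is a Gaussian window in y of rate A/(4B) centred at 2 Re z/A - x, where A =
`posScale ε` and B = `momScale ε`. -/
theorem integral_weylHeatIntegrand {ε : ℝ} (h0 : 0 < ε) (h1 : ε < 1) (φ : ℂ → ℂ)
    (f : 𝓢(ℝ, ℂ)) (x ξ : ℝ) (z : ℂ) :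
    ∫ y, weylHeatIntegrand ε φ f x ξ y z = weylPlaneIntegrand ε φ f x ξ z := by
  have hA := posScale_pos h0
  have hB := momScale_pos h0 h1
  rw [weylPlaneIntegrand, windowInt, ← integral_const_mul, ← integral_const_mul]
  refine integral_congr_ae (ae_of_all _ fun y => ?_)
  simp only [weylHeatIntegrand, map_one, one_mul]
  have key : (Real.exp (-(‖z - ((posScale ε : ℂ) * (((x + y) / 2 : ℝ) : ℂ)
      - (momScale ε : ℂ) * Complex.I * ξ)‖ ^ 2 / (posScale ε * momScale ε))) : ℂ)
      * Complex.exp (Complex.I * ((x : ℂ) - y) * ξ)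
      = (Real.exp (-((z.im + momScale ε * ξ) ^ 2 / (posScale ε * momScale ε))) : ℂ)
      * Complex.exp (Complex.I * x * ξ) * Complex.exp (-((posScale ε / (4 * momScale ε) : ℝ) : ℂ)
        * ((y : ℂ) - ((2 * z.re / posScale ε - x : ℝ) : ℂ)) ^ 2 - Complex.I * y * ξ) := by
    have hn : ‖z - ((posScale ε : ℂ) * (((x + y) / 2 : ℝ) : ℂ)
        - (momScale ε : ℂ) * Complex.I * ξ)‖ ^ 2
        = (z.re - posScale ε * ((x + y) / 2)) ^ 2 + (z.im + momScale ε * ξ) ^ 2 := by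
      rw [sq_norm_eq]
      simp
    have hA' : (posScale ε : ℂ) ≠ 0 := by exact_mod_cast hA.ne'
    have hB' : (momScale ε : ℂ) ≠ 0 := by exact_mod_cast hB.ne'
    rw [hn, Complex.ofReal_exp, Complex.ofReal_exp, ← Complex.exp_add, ← Complex.exp_add,
      ← Complex.exp_add]
    congr 1
    push_cast
    field_simp
    ring
  linear_combination (φ z * f y) * key

/-- Each variable has its own source of decay: the bound D for Re z, the heat Gaussian for Im z with
a mass independent of ξ, and (1 + ξ²)⁻¹ for ξ. -/
theorem integrable_weylPlaneIntegrand {ε : ℝ} (h0 : 0 < ε) (h1 : ε < 1) {φ : ℂ → ℂ}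
    (hφ : MemLp φ ∞ (volume : Measure ℂ)) (f : 𝓢(ℝ, ℂ)) (x : ℝ) :
    Integrable (Function.uncurry (weylPlaneIntegrand ε φ f x)) (volume.prod volume) := by
  obtain ⟨M, hM, hφM⟩ := exists_norm_le_of_memLp_top hφ
  have hA := posScale_pos h0
  have hB := momScale_pos h0 h1
  obtain ⟨D, hD, hDb⟩ := exists_norm_windowInt_le_decay
    (a := posScale ε / (4 * momScale ε)) (by positivity) f
  set k : ℝ → ℝ := fun s => Real.exp (-(s ^ 2 / (posScale ε * momScale ε))) with hk
  have hkc : Continuous k := by simp only [hk]; fun_prop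
  have hki : Integrable k := by
    refine (integrable_exp_neg_mul_sq (b := 1 / (posScale ε * momScale ε))
      (by positivity)).congr (ae_of_all _ fun s => ?_)
    simp only [hk]
    congr 1
    ring
  have hDi : Integrable fun r => D (2 * r / posScale ε - x) := by
    have := (hD.comp_sub_right x).comp_mul_right' (R := 2 / posScale ε) (by positivity)
    refine this.congr (ae_of_all _ fun r => ?_)
    simp only
    congr 1
    ring
  have hdom : Integrable (fun v : ℝ × ℂ => M * (D (2 * v.2.re / posScale ε - x)
      * k (v.2.im + momScale ε * v.1)) * (1 + v.1 ^ 2)⁻¹) (volume.prod volume) := by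
    have hm : AEStronglyMeasurable (fun v : ℝ × ℂ => D (2 * v.2.re / posScale ε - x))
        (volume.prod volume) := by
      -- A function of Re z alone need not be integrable on the plane. Its measurability is read off
      -- from the integrable product with k(Im z) by dividing by that positive factor.
      have hk1 : AEStronglyMeasurable (fun z : ℂ => (k z.im)⁻¹) volume :=
        (Continuous.inv₀ (by fun_prop) fun z => (Real.exp_pos _).ne').aestronglyMeasurable
      have h := (integrable_re_mul_im hDi hki).aestronglyMeasurable.mul hk1
      have h' : AEStronglyMeasurable (fun z : ℂ => D (2 * z.re / posScale ε - x)) volume := by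
        refine h.congr (ae_of_all _ fun z => ?_)
        simp only [Pi.mul_apply]
        rw [mul_assoc, mul_inv_cancel₀ (Real.exp_pos _).ne', mul_one]
      exact h'.comp_snd
    have hm2 : Continuous fun v : ℝ × ℂ => k (v.2.im + momScale ε * v.1) := by fun_prop
    have hm3 : Continuous fun v : ℝ × ℂ => (1 + v.1 ^ 2)⁻¹ :=
      Continuous.inv₀ (by fun_prop) fun v => by positivity
    have hmm : AEStronglyMeasurable (fun v : ℝ × ℂ => M * (D (2 * v.2.re / posScale ε - x)
        * k (v.2.im + momScale ε * v.1)) * (1 + v.1 ^ 2)⁻¹) (volume.prod volume) :=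
      ((hm.mul hm2.aestronglyMeasurable).const_mul M).mul hm3.aestronglyMeasurable
    rw [integrable_prod_iff hmm]
    refine ⟨ae_of_all _ fun ξ => ((integrable_re_mul_im hDi
      (hki.comp_add_right (momScale ε * ξ))).const_mul M).mul_const (1 + ξ ^ 2)⁻¹, ?_⟩
    have : ∀ ξ : ℝ, ∫ z : ℂ, ‖M * (D (2 * z.re / posScale ε - x)
        * k (z.im + momScale ε * ξ)) * (1 + ξ ^ 2)⁻¹‖
        = (M * ((∫ r, |D (2 * r / posScale ε - x)|) * ∫ s, k s)) * (1 + ξ ^ 2)⁻¹ := by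
      intro ξ
      rw [← integral_add_right_eq_self k (momScale ε * ξ),
        ← integral_re_mul_im (fun r => |D (2 * r / posScale ε - x)|)
        (fun s => k (s + momScale ε * ξ)), ← integral_const_mul, ← integral_mul_const]
      refine integral_congr_ae (ae_of_all _ fun z => ?_)
      simp only
      have h1 : ‖k (z.im + momScale ε * ξ)‖ = k (z.im + momScale ε * ξ) :=
        Real.norm_of_nonneg (Real.exp_pos _).le
      have h2 : ‖(1 + ξ ^ 2)⁻¹‖ = (1 + ξ ^ 2)⁻¹ := Real.norm_of_nonneg (by positivity)
      rw [norm_mul, norm_mul, norm_mul, Real.norm_of_nonneg hM, h1, h2, Real.norm_eq_abs]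
    simp only [this]
    exact integrable_inv_one_add_sq.const_mul _
  refine hdom.mono' ?_ ?_
  · have m2 : AEStronglyMeasurable (fun v : ℝ × ℂ => φ v.2) (volume.prod volume) := hφ.1.comp_snd
    have m3 : Continuous fun v : ℝ × ℂ => ((k (v.2.im + momScale ε * v.1) : ℝ) : ℂ)
        * Complex.exp (Complex.I * x * v.1) := by fun_prop
    have m4 : StronglyMeasurable fun v : ℝ × ℂ =>
        windowInt (posScale ε / (4 * momScale ε)) 1 f (2 * v.2.re / posScale ε - x) v.1 :=
      (stronglyMeasurable_windowInt _ 1 f).comp_measurable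
        (g := fun v : ℝ × ℂ => (2 * v.2.re / posScale ε - x, v.1)) (by fun_prop)
    exact m2.mul (m3.aestronglyMeasurable.mul m4.aestronglyMeasurable)
  · have h2 : ∀ᵐ v : ℝ × ℂ ∂((volume : Measure ℝ).prod volume), ‖φ v.2‖ ≤ M :=
      Measure.quasiMeasurePreserving_snd.ae hφM
    filter_upwards [h2] with v hv
    obtain ⟨ξ, z⟩ := v
    simp only [Function.uncurry] at hv ⊢
    have e1 : ‖Complex.exp (Complex.I * x * ξ)‖ = 1 := by
      have := norm_cexp_I_mul x 0 ξ
      simpa using this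
    rw [weylPlaneIntegrand, norm_mul, norm_mul, norm_mul, e1, mul_one,
      Complex.norm_real, Real.norm_of_nonneg (Real.exp_pos _).le]
    have hD0 := hDb (2 * z.re / posScale ε - x) ξ
    calc _ ≤ M * (k (z.im + momScale ε * ξ)
          * (D (2 * z.re / posScale ε - x) * (1 + ξ ^ 2)⁻¹)) := by
          gcongr
      _ = _ := by ring

/-- The core identity, the theorem for a point mass at z. With A = `posScale ε` and B = `momScale
ε`, integrating the Gaussian of rate B/A over ξ produces e^{-A(x-y)²/(4B)}. Its product with the
e^{-A(x+y)²/(4B)} from the window is e^{-A(x²+y²)/(2B)}, so the mixed term xy cancels and the kernel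
splits into a factor in x and a factor in y. The constants agree by `sq_kernelCoeff_eq`. -/
theorem integral_weyl_gaussian {ε : ℝ} (h0 : 0 < ε) (h1 : ε < 1) (x y : ℝ) (z : ℂ) :
    ((1 / (2 * Real.pi) * (1 / (Real.pi * (posScale ε * momScale ε))) : ℝ) : ℂ)
      * ∫ ξ : ℝ, (Real.exp (-((z.im + momScale ε * ξ) ^ 2 / (posScale ε * momScale ε))) : ℂ)
        * Complex.exp (Complex.I * x * ξ) * Complex.exp (-((posScale ε / (4 * momScale ε) : ℝ) : ℂ)
        * ((y : ℂ) - ((2 * z.re / posScale ε - x : ℝ) : ℂ)) ^ 2 - Complex.I * y * ξ)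
      = fockKernel ε ((starRingEnd ℂ) z) x * fockKernel ε z y
        * (Real.exp (-(fockRate ε * ‖z‖ ^ 2)) : ℂ) := by
  have hA := posScale_pos h0
  have hB := momScale_pos h0 h1
  have hA' : (posScale ε : ℂ) ≠ 0 := by exact_mod_cast hA.ne'
  have hB' : (momScale ε : ℂ) ≠ 0 := by exact_mod_cast hB.ne'
  have hb : ((-(momScale ε / posScale ε) : ℝ) : ℂ).re < 0 := by
    rw [Complex.ofReal_re, Left.neg_neg_iff]; positivity
  have hC := congrArg (fun t : ℝ => (t : ℂ)) (sq_kernelCoeff_eq h0 h1)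
  have hsqrt : (Real.pi / -((-(momScale ε / posScale ε) : ℝ) : ℂ)) ^ (1 / 2 : ℂ)
      = ((√(Real.pi * posScale ε / momScale ε) : ℝ) : ℂ) := by
    rw [Real.sqrt_eq_rpow, Complex.ofReal_cpow (by positivity)]
    push_cast
    congr 1
    field_simp
  have e : ∀ ξ : ℝ, (Real.exp (-((z.im + momScale ε * ξ) ^ 2 / (posScale ε * momScale ε))) : ℂ)
        * Complex.exp (Complex.I * x * ξ) * Complex.exp (-((posScale ε / (4 * momScale ε) : ℝ) : ℂ)
        * ((y : ℂ) - ((2 * z.re / posScale ε - x : ℝ) : ℂ)) ^ 2 - Complex.I * y * ξ)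
      = Complex.exp (((-(momScale ε / posScale ε) : ℝ) : ℂ) * ξ ^ 2
        + (-(2 * z.im / posScale ε) + Complex.I * (x - y)) * ξ
        + (-(z.im ^ 2 / (posScale ε * momScale ε)) - posScale ε / (4 * momScale ε)
        * ((y : ℂ) - (2 * z.re / posScale ε - x)) ^ 2)) := by
    intro ξ
    rw [Complex.ofReal_exp, ← Complex.exp_add, ← Complex.exp_add]
    congr 1
    push_cast
    field_simp
    ring
  simp only [e]
  rw [integral_cexp_quadratic hb, hsqrt, fockKernel_eq h0 h1, fockKernel_eq h0 h1,
    Complex.ofReal_exp, fockRate_eq h0, sq_norm_eq]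
  have key : Complex.exp (-(z.im ^ 2 / (posScale ε * momScale ε)) - posScale ε / (4 * momScale ε)
        * ((y : ℂ) - (2 * z.re / posScale ε - x)) ^ 2
        - (-(2 * z.im / posScale ε) + Complex.I * (x - y)) ^ 2
          / (4 * ((-(momScale ε / posScale ε) : ℝ) : ℂ)))
      = Complex.exp (-(1 / (4 * (posScale ε * momScale ε))) * (starRingEnd ℂ) z ^ 2
      - posScale ε / (2 * momScale ε) * x ^ 2 + (starRingEnd ℂ) z * x / momScale ε)
      * Complex.exp (-(1 / (4 * (posScale ε * momScale ε))) * z ^ 2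
      - posScale ε / (2 * momScale ε) * y ^ 2 + z * y / momScale ε)
      * Complex.exp ((-(1 / (2 * (posScale ε * momScale ε)) * (z.re ^ 2 + z.im ^ 2)) : ℝ) : ℂ) := by
    rw [← Complex.exp_add, ← Complex.exp_add]
    congr 1
    have hz : z = z.re + z.im * Complex.I := (Complex.re_add_im z).symm
    have hz' : (starRingEnd ℂ) z = z.re - z.im * Complex.I := by
      apply Complex.ext <;> simp
    rw [hz']
    generalize z.re = r at *
    generalize z.im = s at *
    rw [hz]
    push_cast
    field_simp
    linear_combination (4 * (s : ℂ) ^ 2 + 2 * posScale ε ^ 2 * ((x : ℂ) - y) ^ 2) * Complex.I_sq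
  rw [key]
  push_cast at hC ⊢
  linear_combination (-(Complex.exp (-(1 / (4 * (posScale ε * momScale ε))) * (starRingEnd ℂ) z ^ 2
      - posScale ε / (2 * momScale ε) * x ^ 2 + (starRingEnd ℂ) z * x / momScale ε)
      * Complex.exp (-(1 / (4 * (posScale ε * momScale ε))) * z ^ 2
      - posScale ε / (2 * momScale ε) * y ^ 2 + z * y / momScale ε)
      * Complex.exp ((-(1 / (2 * (posScale ε * momScale ε)) * (z.re ^ 2 + z.im ^ 2)) : ℂ)))) * hC

/-- For fixed z the integrand is dominated by a Gaussian in ξ times |f(y)|, so the ξ-integral can be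
taken first and `integral_weyl_gaussian` applies for each y. -/
theorem integral_weylPlaneIntegrand {ε : ℝ} (h0 : 0 < ε) (h1 : ε < 1) (φ : ℂ → ℂ)
    (f : 𝓢(ℝ, ℂ)) (x : ℝ) (z : ℂ) :
    ((1 / (2 * Real.pi) * (1 / (Real.pi * (posScale ε * momScale ε))) : ℝ) : ℂ)
      * ∫ ξ, weylPlaneIntegrand ε φ f x ξ z = toeplitzIntegrand ε φ f x z := by
  have hA := posScale_pos h0
  have hB := momScale_pos h0 h1
  have hf := f.continuous
  have hki : Integrable fun ξ : ℝ =>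
      Real.exp (-((z.im + momScale ε * ξ) ^ 2 / (posScale ε * momScale ε))) := by
    have h := (integrable_exp_neg_mul_sq (b := momScale ε / posScale ε)
      (by positivity)).comp_add_right (z.im / momScale ε)
    refine h.congr (ae_of_all _ fun ξ => ?_)
    simp only
    congr 1
    field_simp
    ring
  set F : ℝ → ℝ → ℂ := fun ξ y =>
    ((Real.exp (-((z.im + momScale ε * ξ) ^ 2 / (posScale ε * momScale ε))) : ℂ)
        * Complex.exp (Complex.I * x * ξ) * Complex.exp (-((posScale ε / (4 * momScale ε) : ℝ) : ℂ)
        * ((y : ℂ) - ((2 * z.re / posScale ε - x : ℝ) : ℂ)) ^ 2 - Complex.I * y * ξ)) * f y with hF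
  have hFi : Integrable (Function.uncurry F) (volume.prod volume) := by
    refine (hki.mul_prod (f.integrable (μ := volume)).norm).mono' ?_ (ae_of_all _ fun v => ?_)
    · refine Continuous.aestronglyMeasurable ?_
      simp only [hF, Function.uncurry_def]
      fun_prop
    · obtain ⟨ξ, y⟩ := v
      have e1 : ‖Complex.exp (Complex.I * x * ξ)‖ = 1 := by
        have := norm_cexp_I_mul x 0 ξ
        simpa using this
      simp only [hF, Function.uncurry]
      rw [norm_mul, norm_mul, norm_mul, e1, mul_one, Complex.norm_real,
        Real.norm_of_nonneg (Real.exp_pos _).le, norm_cexp_window]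
      refine mul_le_mul_of_nonneg_right (mul_le_of_le_one_right (Real.exp_pos _).le ?_)
        (norm_nonneg _)
      refine Real.exp_le_one_iff.2 ?_
      have : 0 ≤ posScale ε / (4 * momScale ε) * (y - (2 * z.re / posScale ε - x)) ^ 2 := by
        positivity
      linarith
  have e : ∀ ξ, weylPlaneIntegrand ε φ f x ξ z = φ z * ∫ y, F ξ y := by
    intro ξ
    rw [weylPlaneIntegrand, windowInt, ← integral_const_mul]
    congr 2
    funext y
    simp only [hF, map_one, one_mul]
    ring
  simp only [e]
  rw [integral_const_mul, integral_integral_swap hFi, toeplitzIntegrand, mul_left_comm,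
    ← integral_const_mul, mul_assoc, mul_assoc]
  congr 1
  rw [← integral_mul_const, ← integral_const_mul]
  refine integral_congr_ae (ae_of_all _ fun y => ?_)
  simp only [hF]
  rw [integral_mul_const, ← mul_assoc, integral_weyl_gaussian h0 h1]
  ring

/-! ### Toeplitz operators as Weyl operators -/

theorem integrable_weylIntegrand_weylSymbol {ε : ℝ} (h0 : 0 < ε) (h1 : ε < 1) {φ : ℂ → ℂ}
    (hφ : MemLp φ ∞ (volume : Measure ℂ)) (f : 𝓢(ℝ, ℂ)) (x ξ : ℝ) :
    Integrable (weylIntegrand (weylSymbol ε φ) f x ξ) := by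
  refine ((integrable_weylHeatIntegrand h0 h1 hφ f x ξ).integral_prod_left.const_mul
    ((1 / (Real.pi * (posScale ε * momScale ε)) : ℝ) : ℂ)).congr (ae_of_all _ fun y => ?_)
  exact (weylIntegrand_weylSymbol h0 φ f x ξ y).symm

theorem integral_weylIntegrand_weylSymbol {ε : ℝ} (h0 : 0 < ε) (h1 : ε < 1) {φ : ℂ → ℂ}
    (hφ : MemLp φ ∞ (volume : Measure ℂ)) (f : 𝓢(ℝ, ℂ)) (x ξ : ℝ) :
    ∫ y, weylIntegrand (weylSymbol ε φ) f x ξ y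
      = (1 / (Real.pi * (posScale ε * momScale ε)) : ℝ) * ∫ z, weylPlaneIntegrand ε φ f x ξ z := by
  simp only [weylIntegrand_weylSymbol h0]
  rw [integral_const_mul, integral_integral_swap (integrable_weylHeatIntegrand h0 h1 hφ f x ξ)]
  simp only [integral_weylHeatIntegrand h0 h1]

/-- Three exchanges of two variables combine here: (y,z) at fixed ξ, then (ξ,z) once y has been
integrated out, and (ξ,y) at fixed z inside `integral_weylPlaneIntegrand`. The outcome is the kernel
form of the Toeplitz operator. -/
theorem isWeylOperator_weylSymbol {ε : ℝ} (h0 : 0 < ε) (h1 : ε < 1) {φ : ℂ → ℂ}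
    (hφ : MemLp φ ∞ (volume : Measure ℂ)) :
    IsWeylOperator (weylSymbol ε φ) (ContinuousLinearMap.adjoint
      (fockV h0 h1 : Lp ℂ 2 (volume : Measure ℝ) →L[ℂ] fockSpace ε) ∘L
        toeplitz ε φ hφ ∘L (fockV h0 h1 : Lp ℂ 2 (volume : Measure ℝ) →L[ℂ] fockSpace ε)) where
  integrable_inner f x ξ := integrable_weylIntegrand_weylSymbol h0 h1 hφ f x ξ
  integrable_outer f x := by
    simp only [integral_weylIntegrand_weylSymbol h0 h1 hφ]
    exact (integrable_weylPlaneIntegrand h0 h1 hφ f x).integral_prod_left.const_mul _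
  eq_integral f := by
    refine (coeFn_adjoint_toeplitz h0 h1 hφ f).trans (ae_of_all _ fun x => ?_)
    simp only [integral_weylIntegrand_weylSymbol h0 h1 hφ]
    rw [integral_const_mul, integral_integral_swap (integrable_weylPlaneIntegrand h0 h1 hφ f x),
      ← mul_assoc, ← Complex.ofReal_mul, ← integral_const_mul]
    exact integral_congr_ae (ae_of_all _ fun z => (integral_weylPlaneIntegrand h0 h1 φ f x z).symm)

/-- Two bounded operators that agree on the dense subspace of Schwartz functions are equal. -/
theorem IsWeylOperator.unique {a : ℝ → ℝ → ℂ}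
    {W W' : Lp ℂ 2 (volume : Measure ℝ) →L[ℂ] Lp ℂ 2 (volume : Measure ℝ)}
    (h : IsWeylOperator a W) (h' : IsWeylOperator a W') : W = W' := by
  have hd : DenseRange (SchwartzMap.toLpCLM ℝ ℂ 2 (volume : Measure ℝ)) :=
    SchwartzMap.denseRange_toLpCLM (by norm_num)
  refine DFunLike.coe_injective (hd.equalizer W.continuous W'.continuous (funext fun f => ?_))
  exact Lp.ext ((h.eq_integral f).trans (h'.eq_integral f).symm)

end HermiteFock

end

theorem theorem6 (ε : ℝ) (hε0 : 0 < ε) (hε1 : ε < 1) :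
    (∃ b : HilbertBasis ℕ ℂ (Lp ℂ 2 (volume : Measure ℝ)), ⇑b = hermiteL2) ∧
    (∃ b : HilbertBasis ℕ ℂ (fockSpace ε), ⇑b = fockE hε0 hε1) ∧
    ∃ V : Lp ℂ 2 (volume : Measure ℝ) ≃ₗᵢ[ℂ] fockSpace ε,
      (∀ f, HasSum (fun n => inner ℂ (hermiteL2 n) f • fockE hε0 hε1 n) (V f)) ∧
      (∀ n, V (hermiteL2 n) = fockE hε0 hε1 n) ∧
      ∀ (φ : ℂ → ℂ) (hφ : MemLp φ ∞ (volume : Measure ℂ))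
        (W : Lp ℂ 2 (volume : Measure ℝ) →L[ℂ] Lp ℂ 2 (volume : Measure ℝ)),
        IsWeylOperator (weylSymbol ε φ) W ↔
          W = ContinuousLinearMap.adjoint (V : Lp ℂ 2 (volume : Measure ℝ) →L[ℂ] fockSpace ε) ∘L
            toeplitz ε φ hφ ∘L (V : Lp ℂ 2 (volume : Measure ℝ) →L[ℂ] fockSpace ε) := by
  refine ⟨⟨hermiteBasis, coe_hermiteBasis⟩, ⟨fockBasis hε0 hε1, coe_fockBasis hε0 hε1⟩,
    fockV hε0 hε1, hasSum_fockV hε0 hε1, fockV_hermiteL2 hε0 hε1, fun φ hφ W => ⟨fun h => ?_, ?_⟩⟩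
  · exact h.unique (isWeylOperator_weylSymbol hε0 hε1 hφ)
  · rintro rfl
    exact isWeylOperator_weylSymbol hε0 hε1 hφ
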